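/- **Setting.** Let $(\mathcal C,\mathbb E,\mathfrak s)$ be an extriangulated category (Nakaoka–Palu). Suppose that whenever a composition $g\circ h$ of morphisms of $\mathcal C$ is a deflation, so is $g$ (the deflation half of condition (WIC); it holds e.g. in all abelian and all triangulated categories). $\mathbb E^i$ ($i\ge 1$) are the higher extension bifunctors of Gorsky–Nakaoka–Palu: $\mathbb E^1=\mathbb E$ and $\mathbb E^{i+1}(X,A)=\int^{M}\mathbb E(M,A)\otimes\mathbb E^{i}(X,M)$. Classes below are classes of objects of $\mathcal C$. **Notation.** For classes $\mathcal A,\mathcal B,\mathcal X,\mathcal Y,\mathcal T$: - $\mathcal A^{\perp}=\{C:\mathbb E^i(A,C)=0\ \forall i\ge 1,\ A\in\mathcal A\}$ and ${}^{\perp}\mathcal A=\{C:\mathbb E^i(C,A)=0\ \forall i\ge 1,\ A\in\mathcal A\}$. $\mathrm{smd}(\mathcal A)$ is the class of all direct summands of objects of $\mathcal A$. - $\mathrm{pd}_{\mathcal A}(C)=\min\{n\in\mathbb N:\mathbb E^k(C,A)=0\ \forall k>n,\ A\in\mathcal A\}$ ($\infty$ if there is no such $n$), $\mathrm{pd}_{\mathcal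 A}(\mathcal B)=\sup_{B\in\mathcal B}\mathrm{pd}_{\mathcal A}(B)$; dually $\mathrm{id}_{\mathcal A}(C)$, with $\mathbb E^k(A,C)$ in place of $\mathbb E^k(C,A)$, and $\mathrm{id}_{\mathcal A}(\mathcal B)$. - $\omega\subseteq\mathcal X$ is a *relative generator* (resp. *relative cogenerator*) in $\mathcal X$ if every $X\in\mathcal X$ admits an $\mathbb E$-triangle $X'\to W\to X\dashrightarrow$ (resp. $X\to W\to X'\dashrightarrow$) with $W\in\omega$, $X'\in\mathcal X$. - $\mathcal Y^{\vee}_{\mathcal X}$ is the class of objects $M$ having, for some $n\ge 0$, a finite $\mathcal Y_{\mathcal X}$-coresolution of length $n$: for $n=0$ this means that $M$ is isomorphic to an object of $\mathcal X\cap\mathcal Y$; for $n\ge 1$, that there is an $\mathbb E$-triangle $M\to Y_0\to N_0\dashrightarrow$ with $Y_0\in\mathcal Y$, $N_0\in\mathcal X$, where $N_0$ has a finite $\mathcal Y_{\mathcal X}$-coresolution of length $n-1$. - For $k\ge1$, $\mathrm{Fac}^{\mathcal X}_k(\mathcal T)$ is the class of objects $C$ for which there are $\mathbb E$-triangles $K_i\to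 T_i\to K_{i-1}\dashrightarrow$ ($1\le i\le k$) with $K_0=C$, $T_i\in\mathcal T\cap\mathcal X$ and $K_i\in\mathcal X$ for $1\le i\le k$. - $f:T'\to Z$ is a *$\mathcal T$-precover* if $T'\in\mathcal T$ and $\mathrm{Hom}(T'',f)$ is surjective for all $T''\in\mathcal T$. - The pair $(\mathcal A,\mathcal B)$ is *hereditary* if $\mathrm{id}_{\mathcal A}(\mathcal B)=0$. It is *$\mathcal X$-complete* if every $X\in\mathcal X$ admits $\mathbb E$-triangles $B\to A\to X\dashrightarrow$ and $X\to B'\to A'\dashrightarrow$ with $A,A'\in\mathcal A\cap\mathcal X$ and $B,B'\in\mathcal B\cap\mathcal X$. **Theorem.** Let $\mathcal X=\mathrm{smd}(\mathcal X)$ be closed under extensions, let $n\in\mathbb N$, and let $\mathcal T$ be a class such that - (T1) $\mathrm{pd}_{\mathcal X}(\mathcal T)\le n$; - (T2) $\mathcal T\cap\mathcal X\subseteq\mathcal T^{\perp}$; - (T3) there is a class $\omega\subseteq\mathcal T^{\vee}_{\mathcal X}$ which is a relative generator in $\mathcal X$; - (T4) there is a class $\alpha\subseteq\mathcal X^{\perp}\cap\mathcal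 T^{\perp}$ which is a relative cogenerator in $\mathcal X$; - (T5) every $Z\in\mathcal X\cap\mathcal T^{\perp}$ admits a $\mathcal T$-precover $T'\to Z$ with $T'\in\mathcal X$. Then: 1. If $\mathcal T=\mathrm{smd}(\mathcal T)$, then ${}^{\perp}(\mathcal T^{\perp}\cap\mathcal X)\cap\mathcal X={}^{\perp}(\mathcal T^{\perp})\cap\mathcal X=\mathcal T^{\vee}_{\mathcal X}\cap\mathcal X=(\mathcal T\cap\mathcal X)^{\vee}_{\mathcal X}\cap\mathcal X$. 2. $\mathcal T^{\perp}\cap\mathcal X=\mathrm{Fac}^{\mathcal X}_k(\mathcal T)\cap\mathcal X$ for all $k\ge\max\{1,\mathrm{pd}_{\mathcal X}(\mathcal T)\}$. 3. If $\mathcal T=\mathrm{smd}(\mathcal T)$, then the pair $({}^{\perp}(\mathcal T^{\perp}),\mathcal T^{\perp})$ is $\mathcal X$-complete and hereditary. -/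

import Mathlib

open CategoryTheory CategoryTheory.Limits

universe w w₁ w₂ v u

namespace Extri

/-! ## AbBifunctors with values in abelian groups -/

/-- Functors `Cᵒᵖ × C → Ab`, in curried form. -/
abbrev AbBifunctor (C : Type u) [Category.{v} C] : Type (max u v (w + 1)) :=
  Cᵒᵖ ⥤ C ⥤ AddCommGrpCat.{w}

namespace AbBifunctor

section Basic

variable {C : Type u} [Category.{v} C]

/-- The abelian group `F(X, A)`, contravariant in `X` and covariant in `A`. -/
abbrev val (F : AbBifunctor.{w} C) (X A : C) : Type w :=
  ((F.obj (Opposite.op X)).obj A : AddCommGrpCat.{w})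

/-- `a_* : F(X, A) → F(X, A')`. -/
def push (F : AbBifunctor.{w} C) {X A A' : C} (a : A ⟶ A') : F.val X A →+ F.val X A' :=
  ((F.obj (Opposite.op X)).map a).hom

/-- `c^* : F(X, A) → F(X', A)`. -/
def pull (F : AbBifunctor.{w} C) {X X' A : C} (c : X' ⟶ X) : F.val X A →+ F.val X' A :=
  ((F.map c.op).app A).hom

theorem push_id (F : AbBifunctor.{w} C) {X A : C} (δ : F.val X A) : F.push (𝟙 A) δ = δ := by
  simp [push]

theorem push_comp (F : AbBifunctor.{w} C) {X A A' A'' : C} (a : A ⟶ A') (a' : A' ⟶ A'')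
    (δ : F.val X A) : F.push (a ≫ a') δ = F.push a' (F.push a δ) := by
  simp [push]

theorem pull_id (F : AbBifunctor.{w} C) {X A : C} (δ : F.val X A) : F.pull (𝟙 X) δ = δ := by
  simp [pull]

theorem pull_comp (F : AbBifunctor.{w} C) {X X' X'' A : C} (c : X' ⟶ X) (c' : X'' ⟶ X')
    (δ : F.val X A) : F.pull (c' ≫ c) δ = F.pull c' (F.pull c δ) := by
  simp [pull]

theorem push_pull (F : AbBifunctor.{w} C) {X X' A A' : C} (c : X' ⟶ X) (a : A ⟶ A')
    (δ : F.val X A) : F.push a (F.pull c δ) = F.pull c (F.push a δ) := by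
  have h := congrArg (fun t => t.hom δ) ((F.map c.op).naturality a)
  simp_all [push, pull]

/-- The same bifunctor, with its values moved to a larger universe. -/
def lift (F : AbBifunctor.{w} C) : AbBifunctor.{max w w₁} C :=
  F ⋙ (Functor.whiskeringRight C _ _).obj AddCommGrpCat.uliftFunctor.{w₁, w}

end Basic

/-! ### The composition `F ⋄ G`

`(F ⋄ G)(X, A)` is the coend `∫^M F(M, A) ⊗ G(X, M)`: the abelian group generated by the symbols
`x ⊗ y` with `x ∈ F(M, A)`, `y ∈ G(X, M)`, `M` any object, subject to biadditivity and to
`(m^* x) ⊗ y = x ⊗ (m_* y)` for every morphism `m : M ⟶ M'`, `x ∈ F(M', A)`, `y ∈ G(X, M)`. -/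

section Diamond

variable {C : Type u} [Category.{v} C]

/-- The generators `x ⊗ y` of `(F ⋄ G)(X, A)`. -/
structure Gen (F : AbBifunctor.{w₁} C) (G : AbBifunctor.{w₂} C) (X A : C) :
    Type (max u w₁ w₂) where
  mid : C
  fst : F.val mid A
  snd : G.val X mid

/-- The elements of the free abelian group that are set equal to zero in `(F ⋄ G)(X, A)`. -/
inductive Rel (F : AbBifunctor.{w₁} C) (G : AbBifunctor.{w₂} C) (X A : C) :
    FreeAbelianGroup (Gen F G X A) → Prop
  | add_left {M : C} (x x' : F.val M A) (y : G.val X M) :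
      Rel F G X A (FreeAbelianGroup.of ⟨M, x + x', y⟩ -
        (FreeAbelianGroup.of ⟨M, x, y⟩ + FreeAbelianGroup.of ⟨M, x', y⟩))
  | add_right {M : C} (x : F.val M A) (y y' : G.val X M) :
      Rel F G X A (FreeAbelianGroup.of ⟨M, x, y + y'⟩ -
        (FreeAbelianGroup.of ⟨M, x, y⟩ + FreeAbelianGroup.of ⟨M, x, y'⟩))
  | balance {M M' : C} (m : M ⟶ M') (x : F.val M' A) (y : G.val X M) :
      Rel F G X A (FreeAbelianGroup.of ⟨M, F.pull m x, y⟩ -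
        FreeAbelianGroup.of ⟨M', x, G.push m y⟩)

/-- The subgroup of relations. -/
def relSubgroup (F : AbBifunctor.{w₁} C) (G : AbBifunctor.{w₂} C) (X A : C) :
    AddSubgroup (FreeAbelianGroup (Gen F G X A)) :=
  AddSubgroup.closure {z | Rel F G X A z}

/-- The abelian group `(F ⋄ G)(X, A)`. -/
abbrev DiamondVal (F : AbBifunctor.{w₁} C) (G : AbBifunctor.{w₂} C) (X A : C) :
    Type (max u w₁ w₂) :=
  FreeAbelianGroup (Gen F G X A) ⧸ relSubgroup F G X A

/-- The class of `x ⊗ y`. -/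
def tmul (F : AbBifunctor.{w₁} C) (G : AbBifunctor.{w₂} C) {X A M : C} (x : F.val M A)
    (y : G.val X M) : DiamondVal F G X A :=
  QuotientAddGroup.mk (FreeAbelianGroup.of ⟨M, x, y⟩)

/-- The action of `c : X' ⟶ X` and `a : A ⟶ A'` on generators: `x ⊗ y ↦ (a_* x) ⊗ (c^* y)`. -/
def Gen.map (F : AbBifunctor.{w₁} C) (G : AbBifunctor.{w₂} C) {X X' A A' : C} (c : X' ⟶ X)
    (a : A ⟶ A') (g : Gen F G X A) : Gen F G X' A' :=
  ⟨g.mid, F.push a g.fst, G.pull c g.snd⟩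

theorem relSubgroup_le (F : AbBifunctor.{w₁} C) (G : AbBifunctor.{w₂} C) {X X' A A' : C}
    (c : X' ⟶ X) (a : A ⟶ A') :
    relSubgroup F G X A ≤
      (relSubgroup F G X' A').comap (FreeAbelianGroup.map (Gen.map F G c a)) := by
  unfold relSubgroup
  rw [AddSubgroup.closure_le]
  rintro _ (⟨x, x', y⟩ | ⟨x, y, y'⟩ | ⟨m, x, y⟩)
  · apply AddSubgroup.subset_closure
    simpa [Gen.map, map_add] using Rel.add_left (F := F) (G := G) (F.push a x) (F.push a x') (G.pull c y)
  · apply AddSubgroup.subset_closure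
    simpa [Gen.map, map_add] using Rel.add_right (F := F) (G := G) (F.push a x) (G.pull c y) (G.pull c y')
  · apply AddSubgroup.subset_closure
    simpa [Gen.map, push_pull] using Rel.balance (F := F) (G := G) m (F.push a x) (G.pull c y)

/-- The action of a pair of morphisms on `F ⋄ G`. -/
def diamondMap (F : AbBifunctor.{w₁} C) (G : AbBifunctor.{w₂} C) {X X' A A' : C}
    (c : X' ⟶ X) (a : A ⟶ A') : DiamondVal F G X A →+ DiamondVal F G X' A' :=
  QuotientAddGroup.map _ _ (FreeAbelianGroup.map (Gen.map F G c a)) (relSubgroup_le F G c a)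

theorem diamondMap_tmul (F : AbBifunctor.{w₁} C) (G : AbBifunctor.{w₂} C) {X X' A A' M : C}
    (c : X' ⟶ X) (a : A ⟶ A') (x : F.val M A) (y : G.val X M) :
    diamondMap F G c a (tmul F G x y) = tmul F G (F.push a x) (G.pull c y) := by
  simp [diamondMap, tmul, Gen.map]

theorem diamond_hom_ext (F : AbBifunctor.{w₁} C) (G : AbBifunctor.{w₂} C) {X A : C}
    {H : Type*} [AddCommGroup H] {f g : DiamondVal F G X A →+ H}
    (h : ∀ (M : C) (x : F.val M A) (y : G.val X M), f (tmul F G x y) = g (tmul F G x y)) :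
    f = g := by
  apply QuotientAddGroup.addMonoidHom_ext
  apply FreeAbelianGroup.lift_ext
  rintro ⟨M, x, y⟩
  exact h M x y

/-- The bifunctor `F ⋄ G`. -/
def diamond (F : AbBifunctor.{w₁} C) (G : AbBifunctor.{w₂} C) : AbBifunctor.{max u w₁ w₂} C where
  obj X :=
    { obj := fun A => AddCommGrpCat.of (DiamondVal F G X.unop A)
      map := fun a => AddCommGrpCat.ofHom (diamondMap F G (𝟙 X.unop) a)
      map_id := fun A => by
        ext1
        apply diamond_hom_ext
        intro M x y
        simp [diamondMap_tmul, push_id, pull_id]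
      map_comp := fun a a' => by
        ext1
        apply diamond_hom_ext
        intro M x y
        simp [diamondMap_tmul, push_comp, pull_id] }
  map {X X'} c :=
    { app := fun A => AddCommGrpCat.ofHom (diamondMap F G c.unop (𝟙 A))
      naturality := fun A A' a => by
        ext1
        apply diamond_hom_ext
        intro M x y
        simp [diamondMap_tmul, push_id, pull_id] }
  map_id X := by
    ext1
    ext1 A
    ext1
    apply diamond_hom_ext
    intro M x y
    simp [diamondMap_tmul, push_id, pull_id]
  map_comp c c' := by
    ext1
    ext1 A
    ext1
    apply diamond_hom_ext
    intro M x y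
    simp [diamondMap_tmul, push_id, pull_comp]

end Diamond

end AbBifunctor

/-! ## Extriangulated categories -/

/-- A structure `(𝔼, 𝔰)` of an extriangulated category (Nakaoka–Palu) on an additive category. -/
structure ExtriangulatedStructure (C : Type u) [Category.{v} C] [Preadditive C]
    [HasZeroObject C] [HasBinaryBiproducts C] : Type (max u v (w + 1)) where
  /-- (ET1) the biadditive functor `𝔼 : Cᵒᵖ × C → Ab`; `E.val Z A` is `𝔼(Z, A)`. -/
  E : AbBifunctor.{w} C
  additive_right : ∀ X : Cᵒᵖ, (E.obj X).Additive
  additive_left : ∀ A : C, (E.flip.obj A).Additive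
  /-- `Triangle x y δ` says that the sequence `x, y` belongs to the class `𝔰(δ)`, that is, that
  `A --x--> B --y--> Z --δ-->` is an `𝔼`-triangle. -/
  Triangle : ∀ {A B Z : C}, (A ⟶ B) → (B ⟶ Z) → E.val Z A → Prop
  /- `𝔰(δ)` is one (nonempty) equivalence class of sequences, two sequences `A ⟶ B ⟶ Z` and
  `A ⟶ B' ⟶ Z` being equivalent if there is an isomorphism `B ≅ B'` compatible with the maps. -/
  exists_triangle : ∀ {A Z : C} (δ : E.val Z A),
    ∃ (B : C) (x : A ⟶ B) (y : B ⟶ Z), Triangle x y δ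
  triangle_unique : ∀ {A B B' Z : C} {x : A ⟶ B} {y : B ⟶ Z} {x' : A ⟶ B'} {y' : B' ⟶ Z}
    {δ : E.val Z A}, Triangle x y δ → Triangle x' y' δ →
    ∃ b : B ≅ B', x ≫ b.hom = x' ∧ b.hom ≫ y' = y
  triangle_of_iso : ∀ {A B B' Z : C} {x : A ⟶ B} {y : B ⟶ Z} {x' : A ⟶ B'} {y' : B' ⟶ Z}
    {δ : E.val Z A} (b : B ≅ B'), x ≫ b.hom = x' → b.hom ≫ y' = y →
    Triangle x y δ → Triangle x' y' δ
  /-- (ET2) `𝔰` is a realization: morphisms of extensions are realized. -/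
  realize_hom : ∀ {A B Z A' B' Z' : C} {x : A ⟶ B} {y : B ⟶ Z} {δ : E.val Z A}
    {x' : A' ⟶ B'} {y' : B' ⟶ Z'} {δ' : E.val Z' A'}, Triangle x y δ → Triangle x' y' δ' →
    ∀ (a : A ⟶ A') (c : Z ⟶ Z'), E.push a δ = E.pull c δ' →
    ∃ b : B ⟶ B', x ≫ b = a ≫ x' ∧ y ≫ c = b ≫ y'
  /-- (ET2) `𝔰(0)` is the split sequence. -/
  triangle_zero : ∀ A Z : C,
    Triangle (biprod.inl : A ⟶ A ⊞ Z) (biprod.snd : A ⊞ Z ⟶ Z) (0 : E.val Z A)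
  /-- (ET2) `𝔰(δ ⊕ δ') = 𝔰(δ) ⊕ 𝔰(δ')`. -/
  triangle_sum : ∀ {A B Z A' B' Z' : C} {x : A ⟶ B} {y : B ⟶ Z} {δ : E.val Z A}
    {x' : A' ⟶ B'} {y' : B' ⟶ Z'} {δ' : E.val Z' A'}, Triangle x y δ → Triangle x' y' δ' →
    Triangle (biprod.map x x') (biprod.map y y')
      (E.pull (biprod.fst : Z ⊞ Z' ⟶ Z) (E.push (biprod.inl : A ⟶ A ⊞ A') δ) +
        E.pull (biprod.snd : Z ⊞ Z' ⟶ Z') (E.push (biprod.inr : A' ⟶ A ⊞ A') δ'))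
  /-- (ET3) -/
  et3 : ∀ {A B Z A' B' Z' : C} {x : A ⟶ B} {y : B ⟶ Z} {δ : E.val Z A}
    {x' : A' ⟶ B'} {y' : B' ⟶ Z'} {δ' : E.val Z' A'}, Triangle x y δ → Triangle x' y' δ' →
    ∀ (a : A ⟶ A') (b : B ⟶ B'), x ≫ b = a ≫ x' →
    ∃ c : Z ⟶ Z', y ≫ c = b ≫ y' ∧ E.push a δ = E.pull c δ'
  /-- (ET3)ᵒᵖ -/
  et3op : ∀ {A B Z A' B' Z' : C} {x : A ⟶ B} {y : B ⟶ Z} {δ : E.val Z A}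
    {x' : A' ⟶ B'} {y' : B' ⟶ Z'} {δ' : E.val Z' A'}, Triangle x y δ → Triangle x' y' δ' →
    ∀ (b : B ⟶ B') (c : Z ⟶ Z'), y ≫ c = b ≫ y' →
    ∃ a : A ⟶ A', x ≫ b = a ≫ x' ∧ E.push a δ = E.pull c δ'
  /-- (ET4) -/
  et4 : ∀ {A B D Q F : C} {f : A ⟶ B} {f' : B ⟶ D} {δ : E.val D A}
    {g : B ⟶ Q} {g' : Q ⟶ F} {δ' : E.val F B}, Triangle f f' δ → Triangle g g' δ' →
    ∃ (P : C) (h' : Q ⟶ P) (d : D ⟶ P) (e : P ⟶ F) (δ'' : E.val P A),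
      Triangle (f ≫ g) h' δ'' ∧ g ≫ h' = f' ≫ d ∧ h' ≫ e = g' ∧
      Triangle d e (E.push f' δ') ∧ E.pull d δ'' = δ ∧ E.push f δ'' = E.pull e δ'
  /-- (ET4)ᵒᵖ -/
  et4op : ∀ {D A B F Q : C} {f' : D ⟶ A} {f : A ⟶ B} {δ : E.val B D}
    {g' : F ⟶ B} {g : B ⟶ Q} {δ' : E.val Q F}, Triangle f' f δ → Triangle g' g δ' →
    ∃ (P : C) (h' : P ⟶ A) (d : D ⟶ P) (e : P ⟶ F) (δ'' : E.val Q P),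
      Triangle h' (f ≫ g) δ'' ∧ d ≫ h' = f' ∧ h' ≫ f = e ≫ g' ∧
      Triangle d e (E.pull g' δ) ∧ E.push e δ'' = δ' ∧ E.push d δ = E.pull g δ''

namespace ExtriangulatedStructure

variable {C : Type u} [Category.{v} C] [Preadditive C] [HasZeroObject C] [HasBinaryBiproducts C]

/-- The higher extension bifunctors: `𝔼⁰ = Hom`, `𝔼¹ = 𝔼` and `𝔼ⁿ⁺¹ = 𝔼 ⋄ 𝔼ⁿ` for `n ≥ 1`
(Gorsky–Nakaoka–Palu). -/
noncomputable def extFunctor (ℰ : ExtriangulatedStructure.{w} C) :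
    ℕ → AbBifunctor.{max u v w} C
  | 0 => AbBifunctor.lift.{v, max u w} (preadditiveCoyoneda : Cᵒᵖ ⥤ C ⥤ AddCommGrpCat.{v})
  | 1 => AbBifunctor.lift.{w, max u v} ℰ.E
  | n + 2 => AbBifunctor.diamond ℰ.E (extFunctor ℰ (n + 1))

/-- `𝔼ᵏ(X, A) = 0`. -/
def ExtZero (ℰ : ExtriangulatedStructure.{w} C) (k : ℕ) (X A : C) : Prop :=
  Subsingleton ((ℰ.extFunctor k).val X A)

/-- `A ⟶ B ⟶ Z` is a conflation: `A ⟶ B ⟶ Z --δ-->` is an `𝔼`-triangle for some `δ`. -/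
def Conflation (ℰ : ExtriangulatedStructure.{w} C) {A B Z : C} (x : A ⟶ B) (y : B ⟶ Z) : Prop :=
  ∃ δ : ℰ.E.val Z A, ℰ.Triangle x y δ

/-- There is an `𝔼`-triangle `A ⟶ B ⟶ Z --->`. -/
def IsExtensionOf (ℰ : ExtriangulatedStructure.{w} C) (A B Z : C) : Prop :=
  ∃ (x : A ⟶ B) (y : B ⟶ Z), ℰ.Conflation x y

/-- `y` is a deflation. -/
def IsDeflation (ℰ : ExtriangulatedStructure.{w} C) {B Z : C} (y : B ⟶ Z) : Prop :=
  ∃ (A : C) (x : A ⟶ B), ℰ.Conflation x y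

/-- If a composition `B ⟶ B' ⟶ Z` is a deflation, so is its second factor `B' ⟶ Z`
(the half of the condition (WIC) of Nakaoka–Palu that concerns deflations). -/
def DeflationCancellation (ℰ : ExtriangulatedStructure.{w} C) : Prop :=
  ∀ ⦃B B' Z : C⦄ (h : B ⟶ B') (g : B' ⟶ Z), ℰ.IsDeflation (h ≫ g) → ℰ.IsDeflation g

/-! ### Classes of objects -/

/-- `𝒳^⊥ = {A | 𝔼ⁱ(X, A) = 0 for all i ≥ 1 and X ∈ 𝒳}`. -/
def rightPerp (ℰ : ExtriangulatedStructure.{w} C) (𝒳 : ObjectProperty C) : ObjectProperty C :=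
  fun A => ∀ i : ℕ, 1 ≤ i → ∀ X : C, 𝒳 X → ℰ.ExtZero i X A

/-- `^⊥𝒳 = {A | 𝔼ⁱ(A, X) = 0 for all i ≥ 1 and X ∈ 𝒳}`. -/
def leftPerp (ℰ : ExtriangulatedStructure.{w} C) (𝒳 : ObjectProperty C) : ObjectProperty C :=
  fun A => ∀ i : ℕ, 1 ≤ i → ∀ X : C, 𝒳 X → ℰ.ExtZero i A X

/-- `𝒳` is closed under extensions. -/
def ClosedUnderExtensions (ℰ : ExtriangulatedStructure.{w} C) (𝒳 : ObjectProperty C) : Prop :=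
  ∀ ⦃A B Z : C⦄, ℰ.IsExtensionOf A B Z → 𝒳 A → 𝒳 Z → 𝒳 B

/-- `pd_𝒜(M) = min {n ∈ ℕ | 𝔼ᵏ(M, -)|_𝒜 = 0 for all k > n}` (`⊤` if there is no such `n`). -/
noncomputable def projDimObj (ℰ : ExtriangulatedStructure.{w} C) (𝒜 : ObjectProperty C) (M : C) : ℕ∞ :=
  sInf {m : ℕ∞ | ∃ n : ℕ, m = n ∧ ∀ k : ℕ, n < k → ∀ A : C, 𝒜 A → ℰ.ExtZero k M A}

/-- `pd_𝒜(ℬ) = sup {pd_𝒜(B) | B ∈ ℬ}`. -/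
noncomputable def projDim (ℰ : ExtriangulatedStructure.{w} C) (𝒜 ℬ : ObjectProperty C) : ℕ∞ :=
  sSup {m : ℕ∞ | ∃ B : C, ℬ B ∧ m = ℰ.projDimObj 𝒜 B}

/-- `id_𝒜(M) = min {n ∈ ℕ | 𝔼ᵏ(-, M)|_𝒜 = 0 for all k > n}` (`⊤` if there is no such `n`). -/
noncomputable def injDimObj (ℰ : ExtriangulatedStructure.{w} C) (𝒜 : ObjectProperty C) (M : C) : ℕ∞ :=
  sInf {m : ℕ∞ | ∃ n : ℕ, m = n ∧ ∀ k : ℕ, n < k → ∀ A : C, 𝒜 A → ℰ.ExtZero k A M}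

/-- `id_𝒜(ℬ) = sup {id_𝒜(B) | B ∈ ℬ}`. -/
noncomputable def injDim (ℰ : ExtriangulatedStructure.{w} C) (𝒜 ℬ : ObjectProperty C) : ℕ∞ :=
  sSup {m : ℕ∞ | ∃ B : C, ℬ B ∧ m = ℰ.injDimObj 𝒜 B}

/-- `ω` is a relative generator in `𝒳`. -/
def IsRelativeGenerator (ℰ : ExtriangulatedStructure.{w} C) (ω 𝒳 : ObjectProperty C) : Prop :=
  ω ≤ 𝒳 ∧ ∀ X : C, 𝒳 X → ∃ X' W : C, 𝒳 X' ∧ ω W ∧ ℰ.IsExtensionOf X' W X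

/-- `α` is a relative cogenerator in `𝒳`. -/
def IsRelativeCogenerator (ℰ : ExtriangulatedStructure.{w} C) (α 𝒳 : ObjectProperty C) : Prop :=
  α ≤ 𝒳 ∧ ∀ X : C, 𝒳 X → ∃ W X' : C, α W ∧ 𝒳 X' ∧ ℰ.IsExtensionOf X W X'

/-- `M` has a finite `𝒴_𝒳`-coresolution `M ⟶ Y₀ ⟶ ⋯ ⟶ Yₙ` of length `n`: for `n = 0`, `M` is
(isomorphic to) an object of `𝒳 ∩ 𝒴`; for `n > 0`, there is an `𝔼`-triangle `M ⟶ Y₀ ⟶ N₀ --->`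
with `Y₀ ∈ 𝒴`, `N₀ ∈ 𝒳`, and `N₀` has a finite `𝒴_𝒳`-coresolution of length `n - 1`. -/
def HasFiniteCoresolution (ℰ : ExtriangulatedStructure.{w} C) (𝒴 𝒳 : ObjectProperty C) :
    ℕ → C → Prop
  | 0, M => (𝒳 ⊓ 𝒴).isoClosure M
  | n + 1, M => ∃ Y₀ N₀ : C, 𝒴 Y₀ ∧ 𝒳 N₀ ∧ ℰ.IsExtensionOf M Y₀ N₀ ∧
      HasFiniteCoresolution ℰ 𝒴 𝒳 n N₀

/-- The class `𝒴^∨_𝒳` of the objects that have a finite `𝒴_𝒳`-coresolution. -/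
def coresolved (ℰ : ExtriangulatedStructure.{w} C) (𝒴 𝒳 : ObjectProperty C) : ObjectProperty C :=
  fun M => ∃ n : ℕ, ℰ.HasFiniteCoresolution 𝒴 𝒳 n M

/-- `Fac^𝒳_n(𝒯)` for `n ≥ 1`: the objects `Z` for which there is
`K ⟶ Tₙ ⟶ ⋯ ⟶ T₁ ⟶ Z` composed of `𝔼`-triangles `Kᵢ ⟶ Tᵢ ⟶ Kᵢ₋₁ --->` (`1 ≤ i ≤ n`, `K₀ = Z`,
`Kₙ = K`) with `Tᵢ ∈ 𝒯 ∩ 𝒳` and `Kᵢ ∈ 𝒳`. (For `n = 0` the recursion starts from all objects.) -/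
def Fac (ℰ : ExtriangulatedStructure.{w} C) (𝒳 𝒯 : ObjectProperty C) : ℕ → ObjectProperty C
  | 0 => ⊤
  | n + 1 => fun Z => ∃ K T : C, 𝒳 K ∧ (𝒯 ⊓ 𝒳) T ∧ ℰ.IsExtensionOf K T Z ∧ Fac ℰ 𝒳 𝒯 n K

/-- The pair `(𝒜, ℬ)` is `𝒳`-hereditary. -/
def IsHereditaryRel (ℰ : ExtriangulatedStructure.{w} C) (𝒳 𝒜 ℬ : ObjectProperty C) : Prop :=
  ℰ.injDim (𝒜 ⊓ 𝒳) (ℬ ⊓ 𝒳) = 0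

/-- The pair `(𝒜, ℬ)` is hereditary. -/
def IsHereditary (ℰ : ExtriangulatedStructure.{w} C) (𝒜 ℬ : ObjectProperty C) : Prop :=
  ℰ.IsHereditaryRel ⊤ 𝒜 ℬ

/-- The pair `(𝒜, ℬ)` is left `𝒳`-complete. -/
def IsLeftComplete (ℰ : ExtriangulatedStructure.{w} C) (𝒳 𝒜 ℬ : ObjectProperty C) : Prop :=
  ∀ X : C, 𝒳 X → ∃ B A : C, (ℬ ⊓ 𝒳) B ∧ (𝒜 ⊓ 𝒳) A ∧ ℰ.IsExtensionOf B A X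

/-- The pair `(𝒜, ℬ)` is right `𝒳`-complete. -/
def IsRightComplete (ℰ : ExtriangulatedStructure.{w} C) (𝒳 𝒜 ℬ : ObjectProperty C) : Prop :=
  ∀ X : C, 𝒳 X → ∃ B A : C, (ℬ ⊓ 𝒳) B ∧ (𝒜 ⊓ 𝒳) A ∧ ℰ.IsExtensionOf X B A

/-- The pair `(𝒜, ℬ)` is `𝒳`-complete. -/
def IsComplete (ℰ : ExtriangulatedStructure.{w} C) (𝒳 𝒜 ℬ : ObjectProperty C) : Prop :=
  ℰ.IsLeftComplete 𝒳 𝒜 ℬ ∧ ℰ.IsRightComplete 𝒳 𝒜 ℬ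

end ExtriangulatedStructure

section Classes

variable {C : Type u} [Category.{v} C]

/-- `smd(ℳ)`: the direct summands of the objects of `ℳ`. -/
def smd [Preadditive C] [HasZeroObject C] [HasBinaryBiproducts C] (ℳ : ObjectProperty C) : ObjectProperty C :=
  fun A => ∃ M A' : C, ℳ M ∧ Nonempty (A ⊞ A' ≅ M)

/-- `f : T ⟶ Z` is a `𝒯`-precover. -/
def IsPrecover (𝒯 : ObjectProperty C) {T Z : C} (f : T ⟶ Z) : Prop :=
  𝒯 T ∧ ∀ T' : C, 𝒯 T' → Function.Surjective (fun h : T' ⟶ T => h ≫ f)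

end Classes

/-! ### The conditions (T1)–(T5) -/

namespace ExtriangulatedStructure

variable {C : Type u} [Category.{v} C] [Preadditive C] [HasZeroObject C] [HasBinaryBiproducts C]

/-- (T1) for a given `n`: `pd_𝒳(𝒯) ≤ n`. -/
def T1 (ℰ : ExtriangulatedStructure.{w} C) (n : ℕ) (𝒳 𝒯 : ObjectProperty C) : Prop :=
  ℰ.projDim 𝒳 𝒯 ≤ n

/-- (T2): `𝒯 ∩ 𝒳 ⊆ 𝒯^⊥`. -/
def T2 (ℰ : ExtriangulatedStructure.{w} C) (𝒳 𝒯 : ObjectProperty C) : Prop :=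
  𝒯 ⊓ 𝒳 ≤ ℰ.rightPerp 𝒯

/-- (T3): some `ω ⊆ 𝒯^∨_𝒳` is a relative generator in `𝒳`. -/
def T3 (ℰ : ExtriangulatedStructure.{w} C) (𝒳 𝒯 : ObjectProperty C) : Prop :=
  ∃ ω : ObjectProperty C, ω ≤ ℰ.coresolved 𝒯 𝒳 ∧ ℰ.IsRelativeGenerator ω 𝒳

/-- (T4): some `α ⊆ 𝒳^⊥ ∩ 𝒯^⊥` is a relative cogenerator in `𝒳`. -/
def T4 (ℰ : ExtriangulatedStructure.{w} C) (𝒳 𝒯 : ObjectProperty C) : Prop :=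
  ∃ α : ObjectProperty C, α ≤ ℰ.rightPerp 𝒳 ⊓ ℰ.rightPerp 𝒯 ∧ ℰ.IsRelativeCogenerator α 𝒳

/-- (T5): every `Z ∈ 𝒳 ∩ 𝒯^⊥` admits a `𝒯`-precover `T' ⟶ Z` with `T' ∈ 𝒳`. -/
def T5 (ℰ : ExtriangulatedStructure.{w} C) (𝒳 𝒯 : ObjectProperty C) : Prop :=
  ∀ Z : C, (𝒳 ⊓ ℰ.rightPerp 𝒯) Z → ∃ (T' : C) (f : T' ⟶ Z), 𝒳 T' ∧ IsPrecover 𝒯 f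

end ExtriangulatedStructure

end Extri

-- The groups `𝔼ⁿ` are coends, so the long exact sequences of a triangle have to be extracted from
-- generators and relations. Biproducts collect any element of `(𝔼 ⋄ G)(X, A)` into one symbol `x ⊗
-- y`, and such a symbol vanishes only for an evident reason (`exists_pull_of_dtmul_eq_zero`).
-- Combined with (ET4), this makes `𝔼 ⋄ G` exact along triangles in the covariant variable whenever
-- `G` is half exact. The contravariant variable is handled symmetrically after rewriting `𝔼ⁿ⁺¹` as
-- `𝔼ⁿ ⋄ 𝔼` by associativity. Afterwards only the resulting dimension shifts are needed.
--
-- The tilting argument rests on two approximations. In `exists_cover`, the deflation `W ⟶ Z`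
-- supplied by the generator factors through a `𝒯`-precover of `Z`, because `W` has an inflation
-- into an object of `𝒯` whose cokernel is left orthogonal to `𝒯^⊥`. Cancellation then makes the
-- precover a deflation, with kernel again in `𝒯^⊥ ∩ 𝒳`. In `exists_envelope`, an induction on the
-- bound for the nonzero `𝔼ᵏ(𝒯, X)` combines cogenerator sequences with these covers and yields `X ⟶
-- B ⟶ A`, with `B ∈ 𝒯^⊥ ∩ 𝒳` and `A` coresolved by `𝒯 ∩ 𝒳`.
--
-- If `M` is left orthogonal to `𝒯^⊥ ∩ 𝒳`, so is its envelope `B`; the cover of `B` then splits,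
-- hence `B ∈ 𝒯`, and the envelope starts a coresolution of `M`. Iterated covers identify `𝒯^⊥ ∩ 𝒳`
-- with the `Fac` classes, the converse being a dimension shift. Envelopes are one half of
-- completeness, and Salce's pushout argument gives the other.

universe w₃ w₄

namespace Extri

/-! ### Additivity of bifunctors on elements -/

namespace AbBifunctor

section Additive

variable {C : Type u} [Category.{v} C] [Preadditive C]

/-- Biadditivity of a bifunctor, stated for its actions on elements. -/
structure IsAdditive (F : AbBifunctor.{w} C) : Prop where
  push_add : ∀ {X A A' : C} (f g : A ⟶ A') (δ : F.val X A),
    F.push (f + g) δ = F.push f δ + F.push g δ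
  pull_add : ∀ {X X' A : C} (f g : X' ⟶ X) (δ : F.val X A),
    F.pull (f + g) δ = F.pull f δ + F.pull g δ

variable {F : AbBifunctor.{w} C}

theorem IsAdditive.push_zero (hF : F.IsAdditive) {X A A' : C} (δ : F.val X A) :
    F.push (0 : A ⟶ A') δ = 0 := by
  have h := hF.push_add (0 : A ⟶ A') 0 δ
  simpa using h

theorem IsAdditive.pull_zero (hF : F.IsAdditive) {X X' A : C} (δ : F.val X A) :
    F.pull (0 : X' ⟶ X) δ = 0 := by
  have h := hF.pull_add (0 : X' ⟶ X) 0 δ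
  simpa using h

theorem IsAdditive.push_neg (hF : F.IsAdditive) {X A A' : C} (f : A ⟶ A') (δ : F.val X A) :
    F.push (-f) δ = -F.push f δ := by
  rw [eq_neg_iff_add_eq_zero, ← hF.push_add, neg_add_cancel, hF.push_zero]

theorem IsAdditive.pull_neg (hF : F.IsAdditive) {X X' A : C} (f : X' ⟶ X) (δ : F.val X A) :
    F.pull (-f) δ = -F.pull f δ := by
  rw [eq_neg_iff_add_eq_zero, ← hF.pull_add, neg_add_cancel, hF.pull_zero]

theorem IsAdditive.lift (hF : F.IsAdditive) : (lift.{w, w₁} F).IsAdditive where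
  push_add f g δ := ULift.ext _ _ (hF.push_add f g δ.down)
  pull_add f g δ := ULift.ext _ _ (hF.pull_add f g δ.down)

end Additive

end AbBifunctor

/-! ### Elementary exactness, pullbacks and pushouts of triangles -/

namespace ExtriangulatedStructure

variable {C : Type u} [Category.{v} C] [Preadditive C] [HasZeroObject C] [HasBinaryBiproducts C]
  (ℰ : ExtriangulatedStructure.{w} C)

theorem isAdditive_E : ℰ.E.IsAdditive where
  push_add {X A A'} f g δ := by
    have := ℰ.additive_right (Opposite.op X)
    have h := (ℰ.E.obj (Opposite.op X)).map_add (f := f) (g := g)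
    simp [AbBifunctor.push, h]
  pull_add {X X' A} f g δ := by
    have := ℰ.additive_left A
    have h := (ℰ.E.flip.obj A).map_add (f := f.op) (g := g.op)
    simp only [Functor.flip_obj_map] at h
    simp [AbBifunctor.pull, op_add, h]

variable {ℰ}

open scoped ZeroObject

theorem triangle_id_zero (A : C) : ℰ.Triangle (𝟙 A) (0 : A ⟶ (0 : C)) 0 :=
  ℰ.triangle_of_iso ⟨biprod.fst, biprod.inl, by ext; simp, by simp⟩
    (by simp) ((isZero_zero C).eq_of_tgt _ _) (ℰ.triangle_zero A 0)

theorem triangle_zero_id (Z : C) : ℰ.Triangle (0 : (0 : C) ⟶ Z) (𝟙 Z) 0 :=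
  ℰ.triangle_of_iso ⟨biprod.snd, biprod.inr, by ext; simp, by simp⟩
    (by simp) (by simp) (ℰ.triangle_zero 0 Z)

theorem triangle_inr_fst (A Z : C) :
    ℰ.Triangle (biprod.inr : Z ⟶ A ⊞ Z) (biprod.fst : A ⊞ Z ⟶ A) 0 :=
  ℰ.triangle_of_iso (biprod.braiding Z A) (by ext <;> simp) (by simp) (ℰ.triangle_zero Z A)

namespace Triangle

variable {A B Z : C} {x : A ⟶ B} {y : B ⟶ Z} {δ : ℰ.E.val Z A}

theorem comp_zero (t : ℰ.Triangle x y δ) : x ≫ y = 0 := by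
  obtain ⟨c, hc, -⟩ := ℰ.et3 (triangle_id_zero A) t (𝟙 A) x (by simp)
  simpa using hc.symm

theorem push_eq_zero (t : ℰ.Triangle x y δ) : ℰ.E.push x δ = 0 := by
  obtain ⟨c, -, hc⟩ := ℰ.et3 t (triangle_id_zero B) x (𝟙 B) (by simp)
  simpa using hc

theorem pull_eq_zero (t : ℰ.Triangle x y δ) : ℰ.E.pull y δ = 0 := by
  obtain ⟨c, -, hc⟩ := ℰ.et3op (triangle_zero_id B) t (𝟙 B) y (by simp)
  simpa using hc.symm

/-- (ET3)ᵒᵖ compares the trivial triangle `X ⟶ X ⟶ 0` with the given one. -/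
theorem exists_lift_of_comp_eq_zero (t : ℰ.Triangle x y δ) {X : C} (f : X ⟶ B) (h : f ≫ y = 0) :
    ∃ g : X ⟶ A, g ≫ x = f := by
  obtain ⟨a, ha, -⟩ := ℰ.et3op (triangle_id_zero X) t f 0 (by simp [h])
  exact ⟨a, by simpa using ha.symm⟩

theorem exists_desc_of_comp_eq_zero (t : ℰ.Triangle x y δ) {X : C} (f : B ⟶ X) (h : x ≫ f = 0) :
    ∃ g : Z ⟶ X, y ≫ g = f := by
  obtain ⟨c, hc, -⟩ := ℰ.et3 t (triangle_zero_id X) 0 f (by simp [h])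
  exact ⟨c, by simpa using hc⟩

/-- The vanishing of `f^* δ` makes `(𝟙 A, f)` a morphism from the split extension to `δ`; the second
summand of its realization is the lift. -/
theorem exists_lift (t : ℰ.Triangle x y δ) {X : C} (f : X ⟶ Z) (h : ℰ.E.pull f δ = 0) : ∃ g :
    X ⟶ B, g ≫ y = f := by
  obtain ⟨b, -, hb⟩ := ℰ.realize_hom (ℰ.triangle_zero A X) t (𝟙 A) f (by simp [h])
  exact ⟨biprod.inr ≫ b, by simp [← hb]⟩

theorem exists_desc (t : ℰ.Triangle x y δ) {X : C} (f : A ⟶ X) (h : ℰ.E.push f δ = 0) : ∃ g :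
    B ⟶ X, x ≫ g = f := by
  obtain ⟨b, hb, -⟩ := ℰ.realize_hom t (ℰ.triangle_zero X Z) f (𝟙 Z) (by simp [h])
  exact ⟨b ≫ biprod.fst, by simp [reassoc_of% hb]⟩

/-- If `ε` is realized by `A ⟶ D ⟶ X`, then `x` extends over `D`, and (ET3) completes the extension
to a morphism of triangles whose right component is the required map. -/
theorem exists_pull_eq (t : ℰ.Triangle x y δ) {X : C} (ε : ℰ.E.val X A) (h : ℰ.E.push x ε = 0) :
    ∃ f : X ⟶ Z, ℰ.E.pull f δ = ε := by
  obtain ⟨D, i, p, s⟩ := ℰ.exists_triangle ε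
  obtain ⟨g, hg⟩ := exists_desc s x h
  obtain ⟨c, -, hc⟩ := ℰ.et3 s t (𝟙 A) g (by simp [hg])
  exact ⟨c, by rw [← hc, AbBifunctor.push_id]⟩

theorem exists_push_eq (t : ℰ.Triangle x y δ) {X : C} (ε : ℰ.E.val Z X) (h : ℰ.E.pull y ε = 0) :
    ∃ f : A ⟶ X, ℰ.E.push f δ = ε := by
  obtain ⟨D, i, p, s⟩ := ℰ.exists_triangle ε
  obtain ⟨g, hg⟩ := exists_lift s y h
  obtain ⟨a, -, ha⟩ := ℰ.et3op t s g (𝟙 Z) (by simp [hg])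
  exact ⟨a, by rw [ha, AbBifunctor.pull_id]⟩

/-- (ET4) for `x` followed by the inflation of `ε` gives an extension `Z ⟶ P ⟶ X` of class `y_* ε =
0` and a class on `P` that maps to `e^* ε`; restricting that class along a section of `e` gives the
preimage. -/
theorem exists_push_inflation_eq (t : ℰ.Triangle x y δ) {X : C} (ε : ℰ.E.val X B)
    (h : ℰ.E.push y ε = 0) :
    ∃ ε' : ℰ.E.val X A, ℰ.E.push x ε' = ε := by
  obtain ⟨D, g, g', s⟩ := ℰ.exists_triangle ε
  obtain ⟨P, h', d, e, δ'', -, -, -, t', -, he⟩ := ℰ.et4 t s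
  obtain ⟨r, hr⟩ := exists_lift t' (𝟙 X) (by simp [h])
  refine ⟨ℰ.E.pull r δ'', ?_⟩
  rw [AbBifunctor.push_pull, he, ← AbBifunctor.pull_comp, hr, AbBifunctor.pull_id]

theorem exists_pull_deflation_eq (t : ℰ.Triangle x y δ) {X : C} (ε : ℰ.E.val B X)
    (h : ℰ.E.pull x ε = 0) :
    ∃ ε' : ℰ.E.val Z X, ℰ.E.pull y ε' = ε := by
  obtain ⟨D, g, g', s⟩ := ℰ.exists_triangle ε
  obtain ⟨P, h', d, e, δ'', -, -, -, t', -, he⟩ := ℰ.et4op s t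
  obtain ⟨r, hr⟩ := exists_desc t' (𝟙 X) (by simp [h])
  refine ⟨ℰ.E.push r δ'', ?_⟩
  rw [← AbBifunctor.push_pull, ← he, ← AbBifunctor.push_comp, hr, AbBifunctor.push_id]

/-- The middle component of a morphism of triangles is an isomorphism if the outer ones are. -/
theorem isIso_middle (t : ℰ.Triangle x y δ) {A' B' Z' : C} {x' : A' ⟶ B'} {y' : B' ⟶ Z'}
    {δ' : ℰ.E.val Z' A'}
    (t' : ℰ.Triangle x' y' δ') (a : A ≅ A') (b : B ⟶ B') (c : Z ≅ Z') (h₁ : x ≫ b = a.hom ≫ x')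
    (h₂ : y ≫ c.hom = b ≫ y') (h : ℰ.E.push a.hom δ = ℰ.E.pull c.hom δ') : IsIso b := by
  -- A lift `s` of `y' ≫ c.inv` is a section of `b` up to a map killed by `y'`; that map factors
  -- through `x'`, which allows `s` to be corrected.
  have hsec : ∃ s : B' ⟶ B, s ≫ b = 𝟙 B' := by
    obtain ⟨s, hs⟩ := exists_lift t (y' ≫ c.inv) (by
      have : δ = ℰ.E.push a.inv (ℰ.E.pull c.hom δ') := by
        rw [← h, ← AbBifunctor.push_comp, a.hom_inv_id, AbBifunctor.push_id]
      rw [this, ← AbBifunctor.push_pull, ← AbBifunctor.pull_comp, Category.assoc, c.inv_hom_id,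
        Category.comp_id, pull_eq_zero t', map_zero])
    obtain ⟨r, hr⟩ := exists_lift_of_comp_eq_zero t' (𝟙 B' - s ≫ b) (by
      simp [← h₂, reassoc_of% hs])
    exact ⟨s + r ≫ a.inv ≫ x, by simp [h₁, hr]⟩
  have hret : ∃ s : B' ⟶ B, b ≫ s = 𝟙 B := by
    obtain ⟨s, hs⟩ := exists_desc t' (a.inv ≫ x) (by
      have : δ' = ℰ.E.pull c.inv (ℰ.E.push a.hom δ) := by
        rw [h, ← AbBifunctor.pull_comp, c.inv_hom_id, AbBifunctor.pull_id]
      rw [this, AbBifunctor.push_pull, ← AbBifunctor.push_comp, a.hom_inv_id_assoc,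
        push_eq_zero t, map_zero])
    obtain ⟨r, hr⟩ := exists_desc_of_comp_eq_zero t (𝟙 B - b ≫ s) (by
      simp [reassoc_of% h₁, hs])
    exact ⟨s + y' ≫ c.inv ≫ r, by simp [← reassoc_of% h₂, hr]⟩
  obtain ⟨s, hs⟩ := hsec
  obtain ⟨r, hr⟩ := hret
  have : r = s := by
    calc r = (s ≫ b) ≫ r := by rw [hs, Category.id_comp]
      _ = s := by rw [Category.assoc, hr, Category.comp_id]
  exact ⟨s, by rw [← this, hr], hs⟩

/-- Any realization of the transported extension has an isomorphic middle term by `isIso_middle`,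
and `𝔰(δ)` is closed under such isomorphisms. -/
theorem of_iso_left (t : ℰ.Triangle x y δ) {A' : C} (a : A ≅ A') :
    ℰ.Triangle (a.inv ≫ x) y (ℰ.E.push a.hom δ) := by
  obtain ⟨B', x', y', t'⟩ := ℰ.exists_triangle (ℰ.E.push a.hom δ)
  obtain ⟨b, h₁, h₂⟩ := ℰ.realize_hom t t' a.hom (𝟙 Z) (by simp [AbBifunctor.pull_id])
  have := isIso_middle t t' a b (Iso.refl Z) h₁ h₂ (by simp [AbBifunctor.pull_id])
  refine ℰ.triangle_of_iso (asIso b).symm ?_ ?_ t'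
  · simp [← cancel_mono b, h₁]
  · simp [← h₂]

theorem of_iso_right (t : ℰ.Triangle x y δ) {Z' : C} (c : Z ≅ Z') :
    ℰ.Triangle x (y ≫ c.hom) (ℰ.E.pull c.inv δ) := by
  obtain ⟨B', x', y', t'⟩ := ℰ.exists_triangle (ℰ.E.pull c.inv δ)
  have h : ℰ.E.push (𝟙 A) δ = ℰ.E.pull c.hom (ℰ.E.pull c.inv δ) := by
    rw [← AbBifunctor.pull_comp, c.hom_inv_id, AbBifunctor.push_id, AbBifunctor.pull_id]
  obtain ⟨b, h₁, h₂⟩ := ℰ.realize_hom t t' (𝟙 A) c.hom h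
  have := isIso_middle t t' (Iso.refl A) b c h₁ h₂ h
  refine ℰ.triangle_of_iso (asIso b).symm ?_ ?_ t'
  · simp [← cancel_mono b, h₁]
  · simp [h₂]

/-- The sequence `A ⟶ W ⊞ B ⟶ W ⊞ Z` obtained from `A ⟶ B ⟶ Z` by adding `𝟙 W`. -/
theorem map_id (t : ℰ.Triangle x y δ) (W : C) :
    ℰ.Triangle (x ≫ (biprod.inr : B ⟶ W ⊞ B)) (biprod.map (𝟙 W) y)
    (ℰ.E.pull (biprod.snd : W ⊞ Z ⟶ Z) δ) := by
  have s := of_iso_left (ℰ.triangle_sum (triangle_zero_id W) t)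
    ⟨biprod.snd, biprod.inr, by ext; simp, by simp⟩
  simpa [← AbBifunctor.push_comp, AbBifunctor.push_pull, AbBifunctor.push_id] using s

/-- The sequence `W ⊞ A ⟶ W ⊞ B ⟶ Z` obtained from `A ⟶ B ⟶ Z` by adding `𝟙 W`. -/
theorem map_id' (t : ℰ.Triangle x y δ) (W : C) :
    ℰ.Triangle (biprod.map (𝟙 W) x) ((biprod.snd : W ⊞ B ⟶ B) ≫ y)
    (ℰ.E.push (biprod.inr : A ⟶ W ⊞ A) δ) := by
  have s := of_iso_right (ℰ.triangle_sum (triangle_id_zero W) t)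
    ⟨biprod.snd, biprod.inr, by ext; simp, by simp⟩
  simpa [← AbBifunctor.pull_comp, AbBifunctor.pull_id] using s

end Triangle

/-- A morphism of triangles that is the identity on the left term gives a homotopy cartesian
square. -/
theorem exists_conflation_of_pull_eq {A B Z B' Z' : C} {x : A ⟶ B} {y : B ⟶ Z}
    {δ : ℰ.E.val Z A} {x' : A ⟶ B'} {y' : B' ⟶ Z'} {δ' : ℰ.E.val Z' A} (t : ℰ.Triangle x y δ)
    (t' : ℰ.Triangle x' y' δ') (m : Z ⟶ Z') (hm : ℰ.E.pull m δ' = δ) :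
    ∃ β : B ⟶ B', ℰ.Conflation (biprod.lift y β) (biprod.desc (-m) y') := by
  -- The graph of `m` is a split inflation. Restricting `A ⟶ Z ⊞ B' ⟶ Z ⊞ Z'` to it by (ET4)ᵒᵖ
  -- leaves an extension of class `m^* δ' = δ`, whose middle term is therefore `B`.
  have s : ℰ.Triangle (biprod.lift (𝟙 Z) m) (biprod.desc (-m) (𝟙 Z')) 0 :=
    ℰ.triangle_of_iso ⟨biprod.lift biprod.fst (biprod.fst ≫ m + biprod.snd),
      biprod.lift biprod.fst (-biprod.fst ≫ m + biprod.snd),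
      by ext <;> simp, by ext <;> simp⟩ (by ext <;> simp) (by ext <;> simp) (ℰ.triangle_zero Z Z')
  obtain ⟨P, h', d, e, δ'', t₁, -, he, t₂, -, -⟩ := ℰ.et4op (t'.map_id Z) s
  rw [← AbBifunctor.pull_comp, biprod.lift_snd, hm] at t₂
  obtain ⟨b, -, hb⟩ := ℰ.triangle_unique t t₂
  have h₁ : h' ≫ biprod.fst = e := by simpa using congrArg (· ≫ biprod.fst) he
  refine ⟨b.hom ≫ h' ≫ biprod.snd, ℰ.E.push b.inv δ'', ?_⟩
  convert t₁.of_iso_left b.symm using 1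
  · ext <;> simp [h₁, hb]
  · ext <;> simp
  · rfl

/-- A morphism of triangles that is the identity on the right term gives a homotopy cocartesian
square. -/
theorem exists_conflation_of_push_eq {A B Z A' B' : C} {x : A ⟶ B} {y : B ⟶ Z}
    {δ : ℰ.E.val Z A} {x' : A' ⟶ B'} {y' : B' ⟶ Z} {δ' : ℰ.E.val Z A'} (t : ℰ.Triangle x y δ)
    (t' : ℰ.Triangle x' y' δ') (m : A' ⟶ A) (hm : ℰ.E.push m δ' = δ) :
    ∃ β : B' ⟶ B, ℰ.Conflation (biprod.lift (-m) x') (biprod.desc x β) := by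
  have s : ℰ.Triangle (biprod.lift (-m) (𝟙 A')) (biprod.desc (𝟙 A) m) 0 :=
    ℰ.triangle_of_iso ⟨biprod.lift (biprod.fst - biprod.snd ≫ m) biprod.snd,
      biprod.lift (biprod.fst + biprod.snd ≫ m) biprod.snd,
      by ext <;> simp, by ext <;> simp⟩ (by ext <;> simp) (by ext <;> simp)
      (triangle_inr_fst A A')
  obtain ⟨P, h', d, e, δ'', t₁, hd, -, t₂, -, -⟩ := ℰ.et4 s (t'.map_id' A)
  rw [← AbBifunctor.push_comp, biprod.inr_desc, hm] at t₂
  obtain ⟨b, hb, -⟩ := ℰ.triangle_unique t₂ t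
  have h₁ : biprod.inl ≫ h' = d := by simpa using congrArg (biprod.inl ≫ ·) hd
  refine ⟨biprod.inr ≫ h' ≫ b.hom, ℰ.E.pull b.inv δ'', ?_⟩
  convert t₁.of_iso_right b using 1
  · ext <;> simp
  · ext <;> simp [reassoc_of% h₁, hb]

/-- Two triangles with the same third term have a common pullback. -/
theorem exists_pullback {A₁ B₁ A₂ B₂ Z : C} {x₁ : A₁ ⟶ B₁} {y₁ : B₁ ⟶ Z} {δ₁ : ℰ.E.val Z A₁}
    {x₂ : A₂ ⟶ B₂} {y₂ : B₂ ⟶ Z} {δ₂ : ℰ.E.val Z A₂} (t₁ : ℰ.Triangle x₁ y₁ δ₁)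
    (t₂ : ℰ.Triangle x₂ y₂ δ₂) :
    ∃ (P : C) (i₁ : A₁ ⟶ P) (p₂ : P ⟶ B₂) (i₂ : A₂ ⟶ P) (p₁ : P ⟶ B₁),
      ℰ.Triangle i₁ p₂ (ℰ.E.pull y₂ δ₁) ∧ ℰ.Triangle i₂ p₁ (ℰ.E.pull y₁ δ₂) := by
  have hE := ℰ.isAdditive_E
  -- The pullback is the middle term of the extension of `Z` by `A₁ ⊞ A₂` with components `δ₁` and
  -- `δ₂`; dividing out one summand with (ET4) leaves the extension given by the other.
  obtain ⟨P, i, p, t⟩ := ℰ.exists_triangle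
    (ℰ.E.push (biprod.inl : A₁ ⟶ A₁ ⊞ A₂) δ₁ + ℰ.E.push (biprod.inr : A₂ ⟶ A₁ ⊞ A₂) δ₂)
  obtain ⟨P₂, h₂, d₂, e₂, ε₂, s₂, -, -, s₂', -, k₂⟩ := ℰ.et4 (ℰ.triangle_zero A₁ A₂) t
  obtain ⟨P₁, h₁, d₁, e₁, ε₁, s₁, -, -, s₁', -, k₁⟩ := ℰ.et4 (triangle_inr_fst A₁ A₂) t
  replace k₂ := congrArg (ℰ.E.push biprod.fst) k₂
  replace k₁ := congrArg (ℰ.E.push biprod.snd) k₁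
  simp [AbBifunctor.push_pull, ← AbBifunctor.push_comp, AbBifunctor.push_id, hE.push_zero]
    at k₁ k₂ s₁' s₂'
  obtain ⟨b₂, -, hb₂⟩ := ℰ.triangle_unique s₂' t₂
  obtain ⟨b₁, -, hb₁⟩ := ℰ.triangle_unique s₁' t₁
  have r₂ := s₂.of_iso_right b₂
  have r₁ := s₁.of_iso_right b₁
  rw [k₂, ← hb₂, ← AbBifunctor.pull_comp, b₂.inv_hom_id_assoc] at r₂
  rw [k₁, ← hb₁, ← AbBifunctor.pull_comp, b₁.inv_hom_id_assoc] at r₁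
  exact ⟨P, _, _, _, _, r₂, r₁⟩

/-- Two triangles with the same first term have a common pushout. -/
theorem exists_pushout {A B₁ Z₁ B₂ Z₂ : C} {x₁ : A ⟶ B₁} {y₁ : B₁ ⟶ Z₁} {δ₁ : ℰ.E.val Z₁ A}
    {x₂ : A ⟶ B₂} {y₂ : B₂ ⟶ Z₂} {δ₂ : ℰ.E.val Z₂ A} (t₁ : ℰ.Triangle x₁ y₁ δ₁)
    (t₂ : ℰ.Triangle x₂ y₂ δ₂) : ∃ P : C, ℰ.IsExtensionOf B₁ P Z₂ ∧ ℰ.IsExtensionOf B₂ P Z₁ := by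
  have hE := ℰ.isAdditive_E
  obtain ⟨P, i, p, t⟩ := ℰ.exists_triangle
    (ℰ.E.pull (biprod.fst : Z₁ ⊞ Z₂ ⟶ Z₁) δ₁ + ℰ.E.pull (biprod.snd : Z₁ ⊞ Z₂ ⟶ Z₂) δ₂)
  obtain ⟨P₁, h₁, d₁, e₁, ε₁, s₁, -, -, s₁', -, -⟩ := ℰ.et4op t (ℰ.triangle_zero Z₁ Z₂)
  obtain ⟨P₂, h₂, d₂, e₂, ε₂, s₂, -, -, s₂', -, -⟩ := ℰ.et4op t (triangle_inr_fst Z₁ Z₂)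
  simp [← AbBifunctor.pull_comp, AbBifunctor.pull_id, hE.pull_zero] at s₁' s₂'
  obtain ⟨b₂, -, hb₂⟩ := ℰ.triangle_unique s₂' t₂
  obtain ⟨b₁, -, hb₁⟩ := ℰ.triangle_unique s₁' t₁
  exact ⟨P, ⟨_, _, _, s₁.of_iso_left b₁⟩, ⟨_, _, _, s₂.of_iso_left b₂⟩⟩

end ExtriangulatedStructure

/-! ### Calculus of the symbols `x ⊗ y` -/

namespace AbBifunctor

section Tensor

variable {C : Type u} [Category.{v} C] (F : AbBifunctor.{w₁} C) (G : AbBifunctor.{w₂} C)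

/-- `x ⊗ y`, as an element of the group `(diamond F G).val X A`. -/
def dtmul {X A M : C} (x : F.val M A) (y : G.val X M) : (diamond F G).val X A :=
  tmul F G x y

theorem dtmul_add_left {X A M : C} (x x' : F.val M A) (y : G.val X M) :
    dtmul F G (x + x') y = dtmul F G x y + dtmul F G x' y := by
  rw [← sub_eq_zero]
  exact (QuotientAddGroup.eq_zero_iff _).2 (AddSubgroup.subset_closure (Rel.add_left x x' y))

theorem dtmul_add_right {X A M : C} (x : F.val M A) (y y' : G.val X M) :
    dtmul F G x (y + y') = dtmul F G x y + dtmul F G x y' := by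
  rw [← sub_eq_zero]
  exact (QuotientAddGroup.eq_zero_iff _).2 (AddSubgroup.subset_closure (Rel.add_right x y y'))

theorem dtmul_pull {X A M M' : C} (m : M ⟶ M') (x : F.val M' A) (y : G.val X M) :
    dtmul F G (F.pull m x) y = dtmul F G x (G.push m y) := by
  rw [← sub_eq_zero]
  exact (QuotientAddGroup.eq_zero_iff _).2 (AddSubgroup.subset_closure (Rel.balance m x y))

theorem dtmul_zero_left {X A M : C} (y : G.val X M) : dtmul F G (0 : F.val M A) y = 0 := by
  simpa using dtmul_add_left F G (0 : F.val M A) 0 y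

theorem dtmul_zero_right {X A M : C} (x : F.val M A) : dtmul F G x (0 : G.val X M) = 0 := by
  simpa using dtmul_add_right F G x (0 : G.val X M) 0

theorem dtmul_neg_left {X A M : C} (x : F.val M A) (y : G.val X M) :
    dtmul F G (-x) y = -dtmul F G x y := by
  rw [eq_neg_iff_add_eq_zero, ← dtmul_add_left, neg_add_cancel, dtmul_zero_left]

theorem push_dtmul {X A A' M : C} (a : A ⟶ A') (x : F.val M A) (y : G.val X M) :
    (diamond F G).push a (dtmul F G x y) = dtmul F G (F.push a x) y :=
  (diamondMap_tmul F G (𝟙 X) a x y).trans (by rw [pull_id]; rfl)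

theorem pull_dtmul {X X' A M : C} (c : X' ⟶ X) (x : F.val M A) (y : G.val X M) :
    (diamond F G).pull c (dtmul F G x y) = dtmul F G x (G.pull c y) :=
  (diamondMap_tmul F G c (𝟙 A) x y).trans (by rw [push_id]; rfl)

end Tensor

section Additive

variable {C : Type u} [Category.{v} C] [Preadditive C] [HasBinaryBiproducts C]
  {F : AbBifunctor.{w₁} C} {G : AbBifunctor.{w₂} C}

/-- The sum of `x ⊗ y` and `x' ⊗ y'` is a single symbol over `M ⊞ M'`: after balancing, the cross
terms vanish by additivity of `F`. -/
theorem exists_eq_dtmul [Nonempty C] (hF : F.IsAdditive) {X A : C} (ξ : (diamond F G).val X A) :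
    ∃ (M : C) (x : F.val M A) (y : G.val X M), ξ = dtmul F G x y := by
  obtain ⟨z, rfl⟩ : ∃ z : FreeAbelianGroup (Gen F G X A),
    (QuotientAddGroup.mk z : DiamondVal F G X A) = ξ := QuotientAddGroup.mk_surjective _
  induction z using FreeAbelianGroup.induction_on with
  | zero => exact ⟨Classical.arbitrary C, 0, 0, by rw [dtmul_zero_left]; rfl⟩
  | of g => exact ⟨g.mid, g.fst, g.snd, rfl⟩
  | neg g h => exact ⟨g.mid, -g.fst, g.snd, by rw [dtmul_neg_left]; rfl⟩
  | add z z' h h' =>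
    obtain ⟨M, x, y, h⟩ := h
    obtain ⟨M', x', y', h'⟩ := h'
    refine ⟨M ⊞ M', F.pull biprod.fst x + F.pull biprod.snd x',
      G.push biprod.inl y + G.push biprod.inr y', ?_⟩
    refine (congrArg₂ (· + ·) h h').trans ?_
    simp only [dtmul_add_right, ← dtmul_pull, map_add, ← pull_comp]
    simp [pull_id, hF.pull_zero]

theorem IsAdditive.diamond [Nonempty C] (hF : F.IsAdditive) (hG : G.IsAdditive) :
    (diamond F G).IsAdditive where
  push_add f g δ := by
    obtain ⟨M, x, y, rfl⟩ := exists_eq_dtmul hF δ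
    simp only [push_dtmul, hF.push_add]
    exact dtmul_add_left ..
  pull_add f g δ := by
    obtain ⟨M, x, y, rfl⟩ := exists_eq_dtmul hF δ
    simp only [pull_dtmul, hG.pull_add]
    exact dtmul_add_right ..

/-! ### When does `x ⊗ y` vanish? -/

/-- The images in `G(X, M)` under the morphisms `f : N ⟶ M` with `f^* x = 0`. -/
def pushedFromKernel (G : AbBifunctor.{w₂} C) (hF : F.IsAdditive) (X : C) {A M : C}
    (x : F.val M A) :
    AddSubgroup (G.val X M) where
  carrier := {t | ∃ (N : C) (f : N ⟶ M) (s : G.val X N), F.pull f x = 0 ∧ G.push f s = t}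
  zero_mem' := ⟨M, 0, 0, hF.pull_zero x, by simp⟩
  neg_mem' := by
    rintro _ ⟨N, f, s, h, rfl⟩
    exact ⟨N, f, -s, h, by simp⟩
  add_mem' := by
    rintro _ _ ⟨N, f, s, h, rfl⟩ ⟨N', f', s', h', rfl⟩
    refine ⟨N ⊞ N', biprod.desc f f', G.push biprod.inl s + G.push biprod.inr s', ?_, ?_⟩
    · rw [biprod.desc_eq, hF.pull_add, pull_comp, pull_comp, h, h']
      simp
    · simp [← push_comp]

/-- The images in `F(M, A)` under the morphisms `f : M ⟶ N` with `f_* y = 0`. -/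
def pulledFromKernel (F : AbBifunctor.{w₁} C) (hG : G.IsAdditive) (A : C) {X M : C}
    (y : G.val X M) :
    AddSubgroup (F.val M A) where
  carrier := {t | ∃ (N : C) (f : M ⟶ N) (s : F.val N A), G.push f y = 0 ∧ F.pull f s = t}
  zero_mem' := ⟨M, 0, 0, hG.push_zero y, by simp⟩
  neg_mem' := by
    rintro _ ⟨N, f, s, h, rfl⟩
    exact ⟨N, f, -s, h, by simp⟩
  add_mem' := by
    rintro _ _ ⟨N, f, s, h, rfl⟩ ⟨N', f', s', h', rfl⟩
    refine ⟨N ⊞ N', biprod.lift f f', F.pull biprod.fst s + F.pull biprod.snd s', ?_, ?_⟩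
    · rw [biprod.lift_eq, hG.push_add, push_comp, push_comp, h, h']
      simp
    · simp [← pull_comp]

open scoped Classical in
/-- The homomorphism that sends `(m^* x) ⊗ y` to the class of `m_* y`, and the generators that are
not of this form to `0`. -/
noncomputable def pushTest (G : AbBifunctor.{w₂} C) (hF : F.IsAdditive) (X : C) {A M : C}
    (x : F.val M A) :
    FreeAbelianGroup (Gen F G X A) →+ G.val X M ⧸ pushedFromKernel G hF X x :=
  FreeAbelianGroup.lift fun g => if h : ∃ m : g.mid ⟶ M, F.pull m x = g.fst then
    QuotientAddGroup.mk (G.push h.choose g.snd) else 0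

open scoped Classical in
/-- The homomorphism that sends `x ⊗ (m_* y)` to the class of `m^* x`, and the generators that are
not of this form to `0`. -/
noncomputable def pullTest (F : AbBifunctor.{w₁} C) (hG : G.IsAdditive) (A : C) {X M : C}
    (y : G.val X M) :
    FreeAbelianGroup (Gen F G X A) →+ F.val M A ⧸ pulledFromKernel F hG A y :=
  FreeAbelianGroup.lift fun g => if h : ∃ m : M ⟶ g.mid, G.push m y = g.snd then
    QuotientAddGroup.mk (F.pull h.choose g.fst) else 0

/-- Two choices of `m` differ by a morphism along which `x` vanishes, so modulo `pushedFromKernel`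
the choice is irrelevant. -/
theorem pushTest_of (hF : F.IsAdditive) (hG : G.IsAdditive) {X A M N : C} {x : F.val M A}
    (m : N ⟶ M) {x' : F.val N A}
    (h : F.pull m x = x') (y : G.val X N) :
    pushTest G hF X x (FreeAbelianGroup.of ⟨N, x', y⟩) = QuotientAddGroup.mk (G.push m y) := by
  have h' : ∃ m : N ⟶ M, F.pull m x = x' := ⟨m, h⟩
  simp only [pushTest, FreeAbelianGroup.lift_apply_of, dif_pos h']
  refine QuotientAddGroup.eq.2 ⟨N, m - h'.choose, y, ?_, ?_⟩
  · rw [sub_eq_add_neg, hF.pull_add, hF.pull_neg, h'.choose_spec, h, add_neg_cancel]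
  · rw [sub_eq_add_neg, hG.push_add, hG.push_neg, add_comm]

theorem pullTest_of (hF : F.IsAdditive) (hG : G.IsAdditive) {X A M N : C} {y : G.val X M}
    (m : M ⟶ N) {y' : G.val X N}
    (h : G.push m y = y') (x : F.val N A) :
    pullTest F hG A y (FreeAbelianGroup.of ⟨N, x, y'⟩) = QuotientAddGroup.mk (F.pull m x) := by
  have h' : ∃ m : M ⟶ N, G.push m y = y' := ⟨m, h⟩
  simp only [pullTest, FreeAbelianGroup.lift_apply_of, dif_pos h']
  refine QuotientAddGroup.eq.2 ⟨N, m - h'.choose, x, ?_, ?_⟩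
  · rw [sub_eq_add_neg, hG.push_add, hG.push_neg, h'.choose_spec, h, add_neg_cancel]
  · rw [sub_eq_add_neg, hF.pull_add, hF.pull_neg, add_comm]

/-- `pushTest` need not respect a relation whose left factors are not restrictions of `x`. A given
element involves only finitely many relations, so their left factors can be assembled into one `x'`
on a biproduct; every `x` restricting to `x'` gives a test that kills the element. -/
theorem exists_pushTest_eq_zero (hF : F.IsAdditive) (hG : G.IsAdditive) [Nonempty C] {X A : C}
    {z : FreeAbelianGroup (Gen F G X A)}
    (hz : z ∈ relSubgroup F G X A) :
    ∃ (N : C) (x' : F.val N A), ∀ (M : C) (x : F.val M A) (m : N ⟶ M), F.pull m x = x' →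
      pushTest G hF X x z = 0 := by
  induction hz using AddSubgroup.closure_induction with
  | mem z h =>
    rcases h with @⟨N, x, x', y⟩ | @⟨N, x, y, y'⟩ | @⟨N, N', k, x, y⟩
    · refine ⟨N ⊞ N, F.pull biprod.fst x + F.pull biprod.snd x', fun M x₀ m hm => ?_⟩
      have h₁ : F.pull (biprod.inl ≫ m) x₀ = x := by
        rw [pull_comp, hm, map_add, ← pull_comp, ← pull_comp]
        simp [pull_id, hF.pull_zero]
      have h₂ : F.pull (biprod.inr ≫ m) x₀ = x' := by
        rw [pull_comp, hm, map_add, ← pull_comp, ← pull_comp]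
        simp [pull_id, hF.pull_zero]
      rw [map_sub, map_add, pushTest_of hF hG _ h₁, pushTest_of hF hG _ h₂,
        pushTest_of hF hG (biprod.inl ≫ m + biprod.inr ≫ m) (by rw [hF.pull_add, h₁, h₂]),
        hG.push_add, QuotientAddGroup.mk_add, sub_self]
    · refine ⟨N, x, fun M x₀ m hm => ?_⟩
      rw [map_sub, map_add, pushTest_of hF hG _ hm, pushTest_of hF hG _ hm,
        pushTest_of hF hG _ hm, map_add, QuotientAddGroup.mk_add, sub_self]
    · refine ⟨N', x, fun M x₀ m hm => ?_⟩
      rw [map_sub, pushTest_of hF hG _ hm,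
        pushTest_of hF hG (k ≫ m) (by rw [pull_comp, hm]), push_comp, sub_self]
  | zero => exact ⟨Classical.arbitrary C, 0, fun _ _ _ _ => map_zero _⟩
  | add z z' _ _ h h' =>
    obtain ⟨N, x, h⟩ := h
    obtain ⟨N', x', h'⟩ := h'
    refine ⟨N ⊞ N', F.pull biprod.fst x + F.pull biprod.snd x', fun M x₀ m hm => ?_⟩
    rw [map_add, h M x₀ (biprod.inl ≫ m), h' M x₀ (biprod.inr ≫ m), add_zero]
    all_goals
      rw [pull_comp, hm, map_add, ← pull_comp, ← pull_comp]
      simp [pull_id, hF.pull_zero]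
  | neg z _ h =>
    obtain ⟨N, x, h⟩ := h
    exact ⟨N, x, fun M x₀ m hm => by rw [map_neg, h M x₀ m hm, neg_zero]⟩

theorem exists_pullTest_eq_zero (hF : F.IsAdditive) (hG : G.IsAdditive) [Nonempty C] {X A : C}
    {z : FreeAbelianGroup (Gen F G X A)}
    (hz : z ∈ relSubgroup F G X A) :
    ∃ (N : C) (y' : G.val X N), ∀ (M : C) (y : G.val X M) (m : M ⟶ N), G.push m y = y' →
      pullTest F hG A y z = 0 := by
  induction hz using AddSubgroup.closure_induction with
  | mem z h =>
    rcases h with @⟨N, x, x', y⟩ | @⟨N, x, y, y'⟩ | @⟨N, N', k, x, y⟩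
    · refine ⟨N, y, fun M y₀ m hm => ?_⟩
      rw [map_sub, map_add, pullTest_of hF hG _ hm, pullTest_of hF hG _ hm,
        pullTest_of hF hG _ hm, map_add, QuotientAddGroup.mk_add, sub_self]
    · refine ⟨N ⊞ N, G.push biprod.inl y + G.push biprod.inr y', fun M y₀ m hm => ?_⟩
      have h₁ : G.push (m ≫ biprod.fst) y₀ = y := by
        rw [push_comp, hm, map_add, ← push_comp, ← push_comp]
        simp [push_id, hG.push_zero]
      have h₂ : G.push (m ≫ biprod.snd) y₀ = y' := by
        rw [push_comp, hm, map_add, ← push_comp, ← push_comp]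
        simp [push_id, hG.push_zero]
      rw [map_sub, map_add, pullTest_of hF hG _ h₁, pullTest_of hF hG _ h₂,
        pullTest_of hF hG (m ≫ biprod.fst + m ≫ biprod.snd) (by rw [hG.push_add, h₁, h₂]),
        hF.pull_add, QuotientAddGroup.mk_add, sub_self]
    · refine ⟨N, y, fun M y₀ m hm => ?_⟩
      rw [map_sub, pullTest_of hF hG _ hm,
        pullTest_of hF hG (m ≫ k) (by rw [push_comp, hm]), pull_comp, sub_self]
  | zero => exact ⟨Classical.arbitrary C, 0, fun _ _ _ _ => map_zero _⟩
  | add z z' _ _ h h' =>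
    obtain ⟨N, y, h⟩ := h
    obtain ⟨N', y', h'⟩ := h'
    refine ⟨N ⊞ N', G.push biprod.inl y + G.push biprod.inr y', fun M y₀ m hm => ?_⟩
    rw [map_add, h M y₀ (m ≫ biprod.fst), h' M y₀ (m ≫ biprod.snd), add_zero]
    all_goals
      rw [push_comp, hm, map_add, ← push_comp, ← push_comp]
      simp [push_id, hG.push_zero]
  | neg z _ h =>
    obtain ⟨N, y, h⟩ := h
    exact ⟨N, y, fun M y₀ m hm => by rw [map_neg, h M y₀ m hm, neg_zero]⟩

/-- If `x ⊗ y = 0`, then this is because `x = m^* x'`, where `m_* y` comes from a morphism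
along which `x'` vanishes. -/
theorem exists_pull_of_dtmul_eq_zero (hF : F.IsAdditive) (hG : G.IsAdditive) [Nonempty C]
    {X A M : C} {x : F.val M A} {y : G.val X M}
    (h : dtmul F G x y = 0) :
    ∃ (M' N : C) (m : M ⟶ M') (f : N ⟶ M') (x' : F.val M' A) (s : G.val X N),
      F.pull m x' = x ∧ F.pull f x' = 0 ∧ G.push f s = G.push m y := by
  obtain ⟨N, x', hx'⟩ := exists_pushTest_eq_zero hF hG ((QuotientAddGroup.eq_zero_iff _).1 h)
  -- Both `x'` and `x` are restrictions of one class on `N ⊞ M`. The test for that class kills `x ⊗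
  -- y`, but also sends it to the class of the image of `y`.
  have h₁ : F.pull biprod.inl (F.pull biprod.fst x' + F.pull (biprod.snd : N ⊞ M ⟶ M) x) = x' := by
    rw [map_add, ← pull_comp, ← pull_comp]
    simp [pull_id, hF.pull_zero]
  have h₂ : F.pull biprod.inr (F.pull (biprod.fst : N ⊞ M ⟶ N) x' + F.pull biprod.snd x) = x := by
    rw [map_add, ← pull_comp, ← pull_comp]
    simp [pull_id, hF.pull_zero]
  have h₃ := hx' _ _ _ h₁
  rw [pushTest_of hF hG _ h₂] at h₃
  obtain ⟨L, f, s, hf, hs⟩ := (QuotientAddGroup.eq_zero_iff _).1 h₃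
  exact ⟨_, L, _, f, _, s, h₂, hf, hs⟩

/-- If `x ⊗ y = 0`, then this is because `y = m_* y'`, where `m^* x` comes from a morphism
along which `y'` vanishes. -/
theorem exists_push_of_dtmul_eq_zero (hF : F.IsAdditive) (hG : G.IsAdditive) [Nonempty C]
    {X A M : C} {x : F.val M A} {y : G.val X M}
    (h : dtmul F G x y = 0) :
    ∃ (M' N : C) (m : M' ⟶ M) (f : M' ⟶ N) (y' : G.val X M') (s : F.val N A),
      G.push m y' = y ∧ G.push f y' = 0 ∧ F.pull f s = F.pull m x := by
  obtain ⟨N, y', hy'⟩ := exists_pullTest_eq_zero hF hG ((QuotientAddGroup.eq_zero_iff _).1 h)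
  have h₁ : G.push biprod.fst (G.push biprod.inl y' + G.push (biprod.inr : M ⟶ N ⊞ M) y) = y' := by
    rw [map_add, ← push_comp, ← push_comp]
    simp [push_id, hG.push_zero]
  have h₂ : G.push biprod.snd (G.push (biprod.inl : N ⟶ N ⊞ M) y' + G.push biprod.inr y) = y := by
    rw [map_add, ← push_comp, ← push_comp]
    simp [push_id, hG.push_zero]
  have h₃ := hy' _ _ _ h₁
  rw [pullTest_of hF hG _ h₂] at h₃
  obtain ⟨L, f, s, hf, hs⟩ := (QuotientAddGroup.eq_zero_iff _).1 h₃
  exact ⟨_, L, _, f, _, s, h₂, hf, hs⟩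

end Additive

/-! ### Associativity of `⋄` -/

section Assoc

variable {C : Type u} [Category.{v} C] (F : AbBifunctor.{w₁} C) (G : AbBifunctor.{w₂} C)

theorem dtmul_hom_ext {X A : C} {H : Type*} [AddCommGroup H] {f g : (diamond F G).val X A →+ H}
    (h : ∀ (M : C) (x : F.val M A) (y : G.val X M), f (dtmul F G x y) = g (dtmul F G x y)) :
    f = g :=
  diamond_hom_ext F G h

/-- The homomorphism out of `(F ⋄ G)(X, A)` given by a balanced biadditive family. -/
def diamondLift {X A : C} {H : Type*}
    [AddCommGroup H] (φ : ∀ M : C, F.val M A →+ G.val X M →+ H)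
    (hφ : ∀ ⦃M M' : C⦄ (m : M ⟶ M') (x : F.val M' A) (y : G.val X M),
      φ M (F.pull m x) y = φ M' x (G.push m y)) : (diamond F G).val X A →+ H :=
  QuotientAddGroup.lift (relSubgroup F G X A) (FreeAbelianGroup.lift fun g => φ g.mid g.fst g.snd)
    (by
      rw [relSubgroup, AddSubgroup.closure_le]
      rintro _ (⟨x, x', y⟩ | ⟨x, y, y'⟩ | ⟨m, x, y⟩) <;> simp [hφ])

theorem diamondLift_dtmul {X A M : C} {H : Type*}
    [AddCommGroup H] (φ : ∀ M : C, F.val M A →+ G.val X M →+ H)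
    (hφ : ∀ ⦃M M' : C⦄ (m : M ⟶ M') (x : F.val M' A) (y : G.val X M),
      φ M (F.pull m x) y = φ M' x (G.push m y)) (x : F.val M A) (y : G.val X M) :
    diamondLift F G φ hφ (dtmul F G x y) = φ M x y :=
  (QuotientAddGroup.lift_mk' _ _ _).trans (FreeAbelianGroup.lift_apply_of _ _)

/-- `x ⊗ y` as a biadditive map. -/
def dtmulHom (X A M : C) : F.val M A →+ G.val X M →+ (diamond F G).val X A :=
  AddMonoidHom.mk' (fun x => AddMonoidHom.mk' (fun y => dtmul F G x y) (dtmul_add_right F G x))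
    fun x x' => by ext y; exact dtmul_add_left F G x x' y

theorem dtmulHom_apply {X A M : C} (x : F.val M A) (y : G.val X M) :
    dtmulHom F G X A M x y = dtmul F G x y := rfl

/-- A natural isomorphism of bifunctors whose values may live in different universes. -/
structure BifunctorEquiv where
  equiv : ∀ X A : C, F.val X A ≃+ G.val X A
  push : ∀ {X A A' : C} (a : A ⟶ A') (x : F.val X A),
    equiv X A' (F.push a x) = G.push a (equiv X A x)
  pull : ∀ {X X' A : C} (c : X' ⟶ X) (x : F.val X A),
    equiv X' A (F.pull c x) = G.pull c (equiv X A x)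

end Assoc

section Equiv

variable {C : Type u} [Category.{v} C] {F : AbBifunctor.{w₁} C} {G : AbBifunctor.{w₂} C}
  {H : AbBifunctor.{w₃} C} {K : AbBifunctor.{w₄} C}

namespace BifunctorEquiv

/-- The identity. -/
def refl (F : AbBifunctor.{w₁} C) : BifunctorEquiv F F where
  equiv _ _ := AddEquiv.refl _
  push _ _ := rfl
  pull _ _ := rfl

/-- The inverse. -/
def symm (e : BifunctorEquiv F G) : BifunctorEquiv G F where
  equiv X A := (e.equiv X A).symm
  push a x := by rw [AddEquiv.symm_apply_eq, e.push, AddEquiv.apply_symm_apply]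
  pull a x := by rw [AddEquiv.symm_apply_eq, e.pull, AddEquiv.apply_symm_apply]

/-- The composition. -/
def trans (e : BifunctorEquiv F G) (e' : BifunctorEquiv G H) : BifunctorEquiv F H where
  equiv X A := (e.equiv X A).trans (e'.equiv X A)
  push a x := by simp [e.push, e'.push]
  pull a x := by simp [e.pull, e'.pull]

/-- Moving the values to a larger universe. -/
def lift (F : AbBifunctor.{w} C) : BifunctorEquiv (AbBifunctor.lift.{w, w₁} F) F where
  equiv _ _ := AddEquiv.ulift
  push _ _ := rfl
  pull _ _ := rfl

/-- The action of a pair of natural isomorphisms on `F ⋄ G`, on elements. -/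
def diamondHom (e : BifunctorEquiv F H) (e' : BifunctorEquiv G K) (X A : C) :
    (AbBifunctor.diamond F G).val X A →+ (AbBifunctor.diamond H K).val X A :=
  diamondLift F G
    (fun M => ((dtmulHom H K X A M).comp (e.equiv M A).toAddMonoidHom).compl₂
      (e'.equiv X M).toAddMonoidHom)
    fun _ _ m x y => by simp [dtmulHom_apply, e.pull, e'.push, dtmul_pull]

theorem diamondHom_dtmul (e : BifunctorEquiv F H) (e' : BifunctorEquiv G K) {X A M : C}
    (x : F.val M A) (y : G.val X M) :
    diamondHom e e' X A (dtmul F G x y) = dtmul H K (e.equiv M A x) (e'.equiv X M y) :=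
  diamondLift_dtmul F G _ _ x y

/-- The action of a pair of natural isomorphisms on `F ⋄ G`. -/
def diamond (e : BifunctorEquiv F H) (e' : BifunctorEquiv G K) :
    BifunctorEquiv (AbBifunctor.diamond F G) (AbBifunctor.diamond H K) where
  equiv X A := (diamondHom e e' X A).toAddEquiv (diamondHom e.symm e'.symm X A)
    (dtmul_hom_ext _ _ fun M x y => by simp [diamondHom_dtmul, symm])
    (dtmul_hom_ext _ _ fun M x y => by simp [diamondHom_dtmul, symm])
  push {X A A'} a x := by
    refine DFunLike.congr_fun (f := (diamondHom e e' X A').comp ((AbBifunctor.diamond F G).push a))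
      (g := ((AbBifunctor.diamond H K).push a).comp (diamondHom e e' X A))
      (dtmul_hom_ext _ _ fun M x y => ?_) x
    rw [AddMonoidHom.comp_apply, AddMonoidHom.comp_apply, diamondHom_dtmul, push_dtmul,
      push_dtmul, diamondHom_dtmul, e.push]
  pull {X X' A} a x := by
    refine DFunLike.congr_fun (f := (diamondHom e e' X' A).comp ((AbBifunctor.diamond F G).pull a))
      (g := ((AbBifunctor.diamond H K).pull a).comp (diamondHom e e' X A))
      (dtmul_hom_ext _ _ fun M x y => ?_) x
    rw [AddMonoidHom.comp_apply, AddMonoidHom.comp_apply, diamondHom_dtmul, pull_dtmul,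
      pull_dtmul, diamondHom_dtmul, e'.pull]

end BifunctorEquiv

variable (F G H)

/-- `t ↦ x ⊗ t`, reassociated. -/
def assocLeft {X A M : C} (x : F.val M A) :
    (diamond G H).val X M →+ (diamond (diamond F G) H).val X A :=
  diamondLift G H
    (fun N => (dtmulHom (diamond F G) H X A N).comp (dtmulHom F G N A M x))
    fun _ _ m y z => by
      simp only [AddMonoidHom.comp_apply, dtmulHom_apply, ← pull_dtmul]
      exact dtmul_pull (diamond F G) H m _ z

theorem assocLeft_dtmul {X A M N : C} (x : F.val M A) (y : G.val N M) (z : H.val X N) :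
    assocLeft F G H x (dtmul G H y z) =
      dtmul (diamond F G) H (dtmul F G x y) z :=
  diamondLift_dtmul G H _ _ y z

/-- `t ↦ t ⊗ z`, reassociated. -/
def assocRight {X A N : C} (z : H.val X N) :
    (diamond F G).val N A →+ (diamond F (diamond G H)).val X A :=
  diamondLift F G
    (fun M => (dtmulHom F (diamond G H) X A M).compl₂ ((dtmulHom G H X M N).flip z))
    fun _ _ m x y => by
      simp only [AddMonoidHom.compl₂_apply, AddMonoidHom.flip_apply, dtmulHom_apply]
      refine (dtmul_pull F (diamond G H) m x _).trans (congrArg _ ?_)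
      exact push_dtmul G H m y z

theorem assocRight_dtmul {X A M N : C} (x : F.val M A) (y : G.val N M) (z : H.val X N) :
    assocRight F G H z (dtmul F G x y) =
      dtmul F (diamond G H) x (dtmul G H y z) :=
  diamondLift_dtmul F G _ _ x y

/-- `x ⊗ (y ⊗ z) ↦ (x ⊗ y) ⊗ z`. -/
def assocHom (X A : C) :
    (diamond F (diamond G H)).val X A →+ (diamond (diamond F G) H).val X A :=
  diamondLift F (diamond G H)
    (fun M => AddMonoidHom.mk' (fun x => assocLeft F G H x) fun x x' =>
      dtmul_hom_ext _ _ fun N y z => by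
        simp only [AddMonoidHom.add_apply, assocLeft_dtmul, dtmul_add_left])
    fun M M' m x t => by
      refine DFunLike.congr_fun (f := assocLeft F G H (F.pull m x))
        (g := (assocLeft F G H x).comp ((diamond G H).push m))
        (dtmul_hom_ext _ _ fun N y z => ?_) t
      rw [AddMonoidHom.comp_apply, push_dtmul, assocLeft_dtmul, assocLeft_dtmul, dtmul_pull]

/-- `(x ⊗ y) ⊗ z ↦ x ⊗ (y ⊗ z)`. -/
def assocInv (X A : C) :
    (diamond (diamond F G) H).val X A →+ (diamond F (diamond G H)).val X A :=
  diamondLift (diamond F G) H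
    (fun N => (AddMonoidHom.mk' (fun z => assocRight F G H z) fun z z' =>
      dtmul_hom_ext _ _ fun M x y => by
        simp only [AddMonoidHom.add_apply, assocRight_dtmul, dtmul_add_right]).flip)
    fun N N' m t z => by
      refine DFunLike.congr_fun (f := (assocRight F G H z).comp ((diamond F G).pull m))
        (g := assocRight F G H (H.push m z))
        (dtmul_hom_ext _ _ fun M x y => ?_) t
      rw [AddMonoidHom.comp_apply, pull_dtmul, assocRight_dtmul, assocRight_dtmul, dtmul_pull]

theorem assocHom_dtmul {X A M N : C} (x : F.val M A) (y : G.val N M) (z : H.val X N) :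
    assocHom F G H X A (dtmul F (diamond G H) x (dtmul G H y z)) =
      dtmul (diamond F G) H (dtmul F G x y) z :=
  (diamondLift_dtmul ..).trans (assocLeft_dtmul ..)

theorem assocInv_dtmul {X A M N : C} (x : F.val M A) (y : G.val N M) (z : H.val X N) :
    assocInv F G H X A (dtmul (diamond F G) H (dtmul F G x y) z) =
      dtmul F (diamond G H) x (dtmul G H y z) :=
  (diamondLift_dtmul ..).trans (assocRight_dtmul ..)

theorem diamond_right_hom_ext {X A : C} {L : Type*} [AddCommGroup L]
    {f g : (diamond F (diamond G H)).val X A →+ L}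
    (h : ∀ (M N : C) (x : F.val M A) (y : G.val N M) (z : H.val X N),
      f (dtmul F (diamond G H) x (dtmul G H y z)) =
        g (dtmul F (diamond G H) x (dtmul G H y z))) : f = g :=
  dtmul_hom_ext _ _ fun M x t => DFunLike.congr_fun
    (f := f.comp (dtmulHom F (diamond G H) X A M x))
    (g := g.comp (dtmulHom F (diamond G H) X A M x))
    (dtmul_hom_ext G H fun N y z => h M N x y z) t

theorem diamond_left_hom_ext {X A : C} {L : Type*} [AddCommGroup L]
    {f g : (diamond (diamond F G) H).val X A →+ L}
    (h : ∀ (M N : C) (x : F.val M A) (y : G.val N M) (z : H.val X N),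
      f (dtmul (diamond F G) H (dtmul F G x y) z) =
        g (dtmul (diamond F G) H (dtmul F G x y) z)) : f = g :=
  dtmul_hom_ext _ _ fun N t z => DFunLike.congr_fun
    (f := f.comp ((dtmulHom (diamond F G) H X A N).flip z))
    (g := g.comp ((dtmulHom (diamond F G) H X A N).flip z))
    (dtmul_hom_ext F G fun M x y => h M N x y z) t

/-- Associativity of `⋄`. -/
def BifunctorEquiv.assoc :
    BifunctorEquiv (AbBifunctor.diamond F (AbBifunctor.diamond G H))
      (AbBifunctor.diamond (AbBifunctor.diamond F G) H) where
  equiv X A := (assocHom F G H X A).toAddEquiv (assocInv F G H X A)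
    (diamond_right_hom_ext F G H fun M N x y z => by
      rw [AddMonoidHom.comp_apply, assocHom_dtmul, assocInv_dtmul, AddMonoidHom.id_apply])
    (diamond_left_hom_ext F G H fun M N x y z => by
      rw [AddMonoidHom.comp_apply, assocInv_dtmul, assocHom_dtmul, AddMonoidHom.id_apply])
  push {X A A'} a t := by
    refine DFunLike.congr_fun (f := (assocHom F G H X A').comp
      ((AbBifunctor.diamond F (AbBifunctor.diamond G H)).push a))
      (g := ((AbBifunctor.diamond (AbBifunctor.diamond F G) H).push a).comp (assocHom F G H X A))
      (diamond_right_hom_ext F G H fun M N x y z => ?_) t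
    rw [AddMonoidHom.comp_apply, AddMonoidHom.comp_apply, push_dtmul, assocHom_dtmul,
      assocHom_dtmul, push_dtmul, push_dtmul]
  pull {X X' A} a t := by
    refine DFunLike.congr_fun (f := (assocHom F G H X' A).comp
      ((AbBifunctor.diamond F (AbBifunctor.diamond G H)).pull a))
      (g := ((AbBifunctor.diamond (AbBifunctor.diamond F G) H).pull a).comp (assocHom F G H X A))
      (diamond_right_hom_ext F G H fun M N x y z => ?_) t
    rw [AddMonoidHom.comp_apply, AddMonoidHom.comp_apply, pull_dtmul, pull_dtmul,
      assocHom_dtmul, assocHom_dtmul, pull_dtmul]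

end Equiv

end AbBifunctor

namespace ExtriangulatedStructure

variable {C : Type u} [Category.{v} C] [Preadditive C] [HasZeroObject C] [HasBinaryBiproducts C]
  (ℰ : ExtriangulatedStructure.{w} C)

open AbBifunctor

/-- `𝔼ⁿ⁺¹ = 𝔼 ⋄ 𝔼ⁿ` is also `𝔼ⁿ ⋄ 𝔼`, for `n ≥ 1`. -/
noncomputable def extFunctorSuccEquiv : ∀ n : ℕ,
    BifunctorEquiv (ℰ.extFunctor (n + 2)) (diamond (ℰ.extFunctor (n + 1)) ℰ.E)
  | 0 => ((BifunctorEquiv.refl ℰ.E).diamond (BifunctorEquiv.lift ℰ.E)).trans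
      ((BifunctorEquiv.lift ℰ.E).symm.diamond (BifunctorEquiv.refl ℰ.E))
  | n + 1 => ((BifunctorEquiv.refl ℰ.E).diamond (extFunctorSuccEquiv n)).trans
      (BifunctorEquiv.assoc ℰ.E (ℰ.extFunctor (n + 1)) ℰ.E)

end ExtriangulatedStructure

/-! ### Exactness of `𝔼 ⋄ G` and `G ⋄ 𝔼` along triangles -/

namespace ExtriangulatedStructure

variable {C : Type u} [Category.{v} C] [Preadditive C] [HasZeroObject C] [HasBinaryBiproducts C]
  (ℰ : ExtriangulatedStructure.{w} C)

open AbBifunctor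

/-- `G(X, -)` is exact in the middle at every triangle. -/
def HalfExactRight (G : AbBifunctor.{w₁} C) : Prop :=
  ∀ ⦃A B Z : C⦄ ⦃x : A ⟶ B⦄ ⦃y : B ⟶ Z⦄ ⦃δ : ℰ.E.val Z A⦄, ℰ.Triangle x y δ →
    ∀ ⦃X : C⦄ (ε : G.val X B), G.push y ε = 0 → ∃ ε' : G.val X A, G.push x ε' = ε

/-- `G(-, X)` is exact in the middle at every triangle. -/
def HalfExactLeft (G : AbBifunctor.{w₁} C) : Prop :=
  ∀ ⦃A B Z : C⦄ ⦃x : A ⟶ B⦄ ⦃y : B ⟶ Z⦄ ⦃δ : ℰ.E.val Z A⦄, ℰ.Triangle x y δ →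
    ∀ ⦃X : C⦄ (ε : G.val B X), G.pull x ε = 0 → ∃ ε' : G.val Z X, G.pull y ε' = ε

variable {ℰ} {G : AbBifunctor.{w₁} C}

theorem HalfExactLeft.of_equiv {G' : AbBifunctor.{w₂} C} (h : ℰ.HalfExactLeft G)
    (e : BifunctorEquiv G' G) : ℰ.HalfExactLeft G' := fun _ B Z x y δ t X ε hε => by
  obtain ⟨ε', hε'⟩ := h t (e.equiv B X ε) (by rw [← e.pull, hε, map_zero])
  refine ⟨(e.equiv Z X).symm ε', (e.equiv B X).injective ?_⟩
  rw [e.pull, AddEquiv.apply_symm_apply, hε']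

theorem HalfExactRight.of_equiv {G' : AbBifunctor.{w₂} C} (h : ℰ.HalfExactRight G)
    (e : BifunctorEquiv G' G) : ℰ.HalfExactRight G' := fun A B _ x y δ t X ε hε => by
  obtain ⟨ε', hε'⟩ := h t (e.equiv X B ε) (by rw [← e.push, hε, map_zero])
  refine ⟨(e.equiv X A).symm ε', (e.equiv X B).injective ?_⟩
  rw [e.push, AddEquiv.apply_symm_apply, hε']

/-- A morphism along which `x'` vanishes factors through the deflation realizing `x'`, so it can be
replaced by that deflation. -/
theorem exists_triangle_of_dtmul_eq_zero (hG : G.IsAdditive) {X A M : C} {x : ℰ.E.val M A}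
    {y : G.val X M} (h : dtmul ℰ.E G x y = 0) :
    ∃ (M' B' : C) (m : M ⟶ M') (i : A ⟶ B') (q : B' ⟶ M') (x' : ℰ.E.val M' A) (s : G.val X B'),
      ℰ.Triangle i q x' ∧ ℰ.E.pull m x' = x ∧ G.push q s = G.push m y := by
  have : Nonempty C := ⟨X⟩
  obtain ⟨M', N, m, f, x', s, hm, hf, hs⟩ := exists_pull_of_dtmul_eq_zero ℰ.isAdditive_E hG h
  obtain ⟨B', i, q, t⟩ := ℰ.exists_triangle x'
  obtain ⟨g, rfl⟩ := t.exists_lift f hf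
  exact ⟨M', B', m, i, q, x', G.push g s, t, hm, by rw [← push_comp, hs]⟩

theorem exists_triangle_of_dtmul_eq_zero' (hG : G.IsAdditive) {X A M : C} {x : G.val M A}
    {y : ℰ.E.val X M} (h : dtmul G ℰ.E x y = 0) :
    ∃ (M' B' : C) (m : M' ⟶ M) (i : M' ⟶ B') (q : B' ⟶ X) (y' : ℰ.E.val X M') (s : G.val B' A),
      ℰ.Triangle i q y' ∧ ℰ.E.push m y' = y ∧ G.pull i s = G.pull m x := by
  have : Nonempty C := ⟨X⟩
  obtain ⟨M', N, m, f, y', s, hm, hf, hs⟩ := exists_push_of_dtmul_eq_zero hG ℰ.isAdditive_E h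
  obtain ⟨B', i, q, t⟩ := ℰ.exists_triangle y'
  obtain ⟨g, rfl⟩ := t.exists_desc f hf
  exact ⟨M', B', m, i, q, y', G.pull g s, t, hm, by rw [← pull_comp, hs]⟩

/-- A half exact functor lifts elements along homotopy cartesian squares. -/
theorem HalfExactRight.exists_push_eq (hG : G.IsAdditive) (h : ℰ.HalfExactRight G)
    {A B Z B' Z' : C} {x : A ⟶ B} {y : B ⟶ Z} {δ : ℰ.E.val Z A} {x' : A ⟶ B'} {y' : B' ⟶ Z'}
    {δ' : ℰ.E.val Z' A} (t : ℰ.Triangle x y δ) (t' : ℰ.Triangle x' y' δ') (m : Z ⟶ Z')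
    (hm : ℰ.E.pull m δ' = δ) {X : C} (z : G.val X Z) (s : G.val X B')
    (hs : G.push y' s = G.push m z) : ∃ b : G.val X B, G.push y b = z := by
  obtain ⟨β, ε, k⟩ := exists_conflation_of_pull_eq t t' m hm
  obtain ⟨b, hb⟩ := h k (G.push biprod.inl z + G.push biprod.inr s) (by
    simp [← push_comp, hG.push_neg, hs])
  refine ⟨b, ?_⟩
  replace hb := congrArg (G.push biprod.fst) hb
  simpa [← push_comp, hG.push_zero, push_id] using hb

/-- A half exact functor extends elements along homotopy cocartesian squares. -/
theorem HalfExactLeft.exists_pull_eq (hG : G.IsAdditive) (h : ℰ.HalfExactLeft G)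
    {A B Z A' B' : C} {x : A ⟶ B} {y : B ⟶ Z} {δ : ℰ.E.val Z A} {x' : A' ⟶ B'} {y' : B' ⟶ Z}
    {δ' : ℰ.E.val Z A'} (t : ℰ.Triangle x y δ) (t' : ℰ.Triangle x' y' δ') (m : A' ⟶ A)
    (hm : ℰ.E.push m δ' = δ) {X : C} (z : G.val A X) (s : G.val B' X)
    (hs : G.pull x' s = G.pull m z) : ∃ b : G.val B X, G.pull x b = z := by
  obtain ⟨β, ε, k⟩ := exists_conflation_of_push_eq t t' m hm
  obtain ⟨b, hb⟩ := h k (G.pull biprod.fst z + G.pull biprod.snd s) (by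
    simp [← pull_comp, hG.pull_neg, hs])
  refine ⟨b, ?_⟩
  replace hb := congrArg (G.pull biprod.inl) hb
  simpa [← pull_comp, hG.pull_zero, pull_id] using hb

/-- Exactness at `G(X, Z)` for the connecting map `z ↦ δ ⊗ z`. -/
theorem HalfExactRight.exists_push_of_dtmul_eq_zero (hG : G.IsAdditive) (h : ℰ.HalfExactRight G)
    {A B Z : C} {x : A ⟶ B} {y : B ⟶ Z}
    {δ : ℰ.E.val Z A} (t : ℰ.Triangle x y δ) {X : C} (z : G.val X Z)
    (hz : dtmul ℰ.E G δ z = 0) : ∃ b : G.val X B, G.push y b = z := by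
  obtain ⟨M', B', m, i, q, x', s, t', hm, hs⟩ := exists_triangle_of_dtmul_eq_zero hG hz
  exact h.exists_push_eq hG t t' m hm z s hs

/-- Exactness at `(𝔼 ⋄ G)(X, A)`. The octahedron on `A ⟶ B ⟶ B'` gives a class `δ''` on `P`
restricting to `δ` on `Z`; the symbol is rewritten as `δ'' ⊗ -`, and its right factor is moved from
`P` to `Z`. -/
theorem HalfExactRight.exists_eq_dtmul_of_push_eq_zero (hG : G.IsAdditive) (h : ℰ.HalfExactRight G)
    {A B Z : C} {x : A ⟶ B} {y : B ⟶ Z}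
    {δ : ℰ.E.val Z A} (t : ℰ.Triangle x y δ) {X : C} (ξ : (diamond ℰ.E G).val X A)
    (hξ : (diamond ℰ.E G).push x ξ = 0) : ∃ z : G.val X Z, ξ = dtmul ℰ.E G δ z := by
  have : Nonempty C := ⟨X⟩
  have hE := ℰ.isAdditive_E
  obtain ⟨M, x₀, y₀, rfl⟩ := exists_eq_dtmul hE ξ
  rw [push_dtmul] at hξ
  obtain ⟨M', B', m, i, q, x', s, t', hm, hs⟩ := exists_triangle_of_dtmul_eq_zero hG hξ
  obtain ⟨P, h', d, e, δ'', t₁, -, he, t₂, hd, hx⟩ := ℰ.et4 t t'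
  obtain ⟨l, hl⟩ := t₂.exists_lift m (by
    rw [← push_pull, hm, ← push_comp, t.comp_zero, hE.push_zero])
  -- The lift `l` of `m` is only determined up to maps through `d`; subtracting `k ≫ d` makes `δ''`
  -- restrict exactly to `x₀`.
  obtain ⟨k, hk⟩ := t.exists_pull_eq (ℰ.E.pull l δ'' - x₀) (by
    rw [map_sub, push_pull, hx, ← pull_comp, hl, hm, sub_self])
  have hr : ℰ.E.pull (l - k ≫ d) δ'' = x₀ := by
    rw [sub_eq_add_neg, hE.pull_add, hE.pull_neg, pull_comp, hd, hk]
    abel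
  have hre : (l - k ≫ d) ≫ e = m := by
    rw [Preadditive.sub_comp, Category.assoc, t₂.comp_zero, hl, comp_zero, sub_zero]
  obtain ⟨z, hz⟩ := h t₂ (G.push (l - k ≫ d) y₀ - G.push h' s) (by
    rw [map_sub, ← push_comp, ← push_comp, hre, he, hs, sub_self])
  refine ⟨z, ?_⟩
  rw [← hr, dtmul_pull, ← sub_add_cancel (G.push (l - k ≫ d) y₀) (G.push h' s), ← hz,
    dtmul_add_right, ← dtmul_pull, ← dtmul_pull, hd, t₁.pull_eq_zero, dtmul_zero_left, add_zero]

/-- The octahedron on `x` and a realization of `x₀` gives `δ''` with `x_* δ'' = e^* x₀`. Since `(y_*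
x₀) ⊗ y₀ = 0`, the element `y₀` lifts along `e` to some `p`, and `δ'' ⊗ p` is the preimage. -/
theorem HalfExactRight.diamond (hG : G.IsAdditive) (h : ℰ.HalfExactRight G) :
    ℰ.HalfExactRight (diamond ℰ.E G) := by
  intro A B Z x y δ t X ξ hξ
  have : Nonempty C := ⟨X⟩
  obtain ⟨M, x₀, y₀, rfl⟩ := exists_eq_dtmul ℰ.isAdditive_E ξ
  rw [push_dtmul] at hξ
  obtain ⟨M', B', m, i, q, x', s, t', hm, hs⟩ := exists_triangle_of_dtmul_eq_zero hG hξ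
  obtain ⟨D, g, g', t₀⟩ := ℰ.exists_triangle x₀
  obtain ⟨P, h', d, e, δ'', -, -, -, t₂, -, hx⟩ := ℰ.et4 t t₀
  obtain ⟨p, rfl⟩ := h.exists_push_eq hG t₂ t' m hm y₀ s hs
  exact ⟨dtmul ℰ.E G δ'' p, by rw [push_dtmul, hx, dtmul_pull]⟩

theorem HalfExactLeft.exists_pull_of_dtmul_eq_zero (hG : G.IsAdditive) (h : ℰ.HalfExactLeft G)
    {A B Z : C} {x : A ⟶ B} {y : B ⟶ Z}
    {δ : ℰ.E.val Z A} (t : ℰ.Triangle x y δ) {X : C} (z : G.val A X)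
    (hz : dtmul G ℰ.E z δ = 0) : ∃ b : G.val B X, G.pull x b = z := by
  obtain ⟨M', B', m, i, q, x', s, t', hm, hs⟩ := exists_triangle_of_dtmul_eq_zero' hG hz
  exact h.exists_pull_eq hG t t' m hm z s hs

theorem HalfExactLeft.diamond (hG : G.IsAdditive) (h : ℰ.HalfExactLeft G) :
    ℰ.HalfExactLeft (diamond G ℰ.E) := by
  intro A B Z x y δ t X ξ hξ
  have : Nonempty C := ⟨X⟩
  obtain ⟨M, x₀, y₀, rfl⟩ := exists_eq_dtmul hG ξ
  rw [pull_dtmul] at hξ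
  obtain ⟨M', B', m, i, q, x', s, t', hm, hs⟩ := exists_triangle_of_dtmul_eq_zero' hG hξ
  obtain ⟨D, g', g, t₀⟩ := ℰ.exists_triangle y₀
  obtain ⟨P, h', d, e, δ'', -, -, -, t₂, -, hx⟩ := ℰ.et4op t₀ t
  obtain ⟨p, rfl⟩ := h.exists_pull_eq hG t₂ t' m hm x₀ s hs
  exact ⟨dtmul G ℰ.E p δ'', by rw [pull_dtmul, ← hx, dtmul_pull]⟩

/-! ### Exactness of the higher extension functors -/

variable (ℰ)

theorem isAdditive_extFunctor : ∀ n : ℕ, (ℰ.extFunctor (n + 1)).IsAdditive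
  | 0 => ℰ.isAdditive_E.lift
  | n + 1 => by
    have : Nonempty C := ⟨(HasZeroObject.zero' C).1⟩
    exact ℰ.isAdditive_E.diamond (isAdditive_extFunctor n)

theorem halfExactRight_extFunctor : ∀ n : ℕ, ℰ.HalfExactRight (ℰ.extFunctor (n + 1))
  | 0 => HalfExactRight.of_equiv (G := ℰ.E)
      (fun _ _ _ _ _ _ t _ ε hε => t.exists_push_inflation_eq ε hε) (BifunctorEquiv.lift ℰ.E)
  | n + 1 => (halfExactRight_extFunctor n).diamond (ℰ.isAdditive_extFunctor n)

/-- Exactness in the first variable acts on the right factor of `⋄`, so `𝔼` has to stand there; this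
is why `extFunctorSuccEquiv` is needed. -/
theorem halfExactLeft_extFunctor : ∀ n : ℕ, ℰ.HalfExactLeft (ℰ.extFunctor (n + 1))
  | 0 => HalfExactLeft.of_equiv (G := ℰ.E)
      (fun _ _ _ _ _ _ t _ ε hε => t.exists_pull_deflation_eq ε hε) (BifunctorEquiv.lift ℰ.E)
  | n + 1 => ((halfExactLeft_extFunctor n).diamond (ℰ.isAdditive_extFunctor n)).of_equiv
      (ℰ.extFunctorSuccEquiv n)

variable {ℰ}

theorem extZero_iff {k : ℕ} {X A : C} :
    ℰ.ExtZero k X A ↔ ∀ ξ : (ℰ.extFunctor k).val X A, ξ = 0 :=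
  ⟨fun h ξ => h.elim ξ 0, fun h => ⟨fun a b => (h a).trans (h b).symm⟩⟩

theorem extZero_one_iff {X A : C} : ℰ.ExtZero 1 X A ↔ ∀ δ : ℰ.E.val X A, δ = 0 :=
  ⟨fun h δ => congrArg ULift.down (extZero_iff.1 h (ULift.up δ)),
    fun h => extZero_iff.2 fun ξ => ULift.ext _ _ (h ξ.down)⟩

/-! ### Dimension shifting -/

section Vanishing

variable {A B Z : C}

theorem IsExtensionOf.extZero_middle (h : ℰ.IsExtensionOf A B Z) {k : ℕ} (hk : 1 ≤ k) {X : C}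
    (hA : ℰ.ExtZero k X A)
    (hZ : ℰ.ExtZero k X Z) : ℰ.ExtZero k X B := by
  obtain ⟨x, y, δ, t⟩ := h
  obtain ⟨n, rfl⟩ := Nat.exists_eq_add_of_le' hk
  rw [extZero_iff] at hA hZ ⊢
  intro ξ
  obtain ⟨ξ', rfl⟩ := ℰ.halfExactRight_extFunctor n t ξ (hZ _)
  rw [hA ξ', map_zero]

theorem IsExtensionOf.extZero_middle' (h : ℰ.IsExtensionOf A B Z) {k : ℕ} (hk : 1 ≤ k) {X : C}
    (hA : ℰ.ExtZero k A X)
    (hZ : ℰ.ExtZero k Z X) : ℰ.ExtZero k B X := by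
  obtain ⟨x, y, δ, t⟩ := h
  obtain ⟨n, rfl⟩ := Nat.exists_eq_add_of_le' hk
  rw [extZero_iff] at hA hZ ⊢
  intro ξ
  obtain ⟨ξ', rfl⟩ := ℰ.halfExactLeft_extFunctor n t ξ (hA _)
  rw [hZ ξ', map_zero]

theorem IsExtensionOf.extZero_left (h : ℰ.IsExtensionOf A B Z) {k : ℕ} (hk : 1 ≤ k) {X : C}
    (hB : ℰ.ExtZero (k + 1) X B)
    (hZ : ℰ.ExtZero k X Z) : ℰ.ExtZero (k + 1) X A := by
  obtain ⟨x, y, δ, t⟩ := h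
  obtain ⟨n, rfl⟩ := Nat.exists_eq_add_of_le' hk
  rw [extZero_iff] at hB hZ ⊢
  intro ξ
  obtain ⟨z, rfl⟩ := (ℰ.halfExactRight_extFunctor n).exists_eq_dtmul_of_push_eq_zero
    (ℰ.isAdditive_extFunctor n) t ξ (hB _)
  rw [hZ z]
  exact dtmul_zero_right _ _ _

theorem IsExtensionOf.extZero_right (h : ℰ.IsExtensionOf A B Z) {k : ℕ} (hk : 1 ≤ k) {X : C}
    (hB : ℰ.ExtZero k X B)
    (hA : ℰ.ExtZero (k + 1) X A) : ℰ.ExtZero k X Z := by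
  obtain ⟨x, y, δ, t⟩ := h
  obtain ⟨n, rfl⟩ := Nat.exists_eq_add_of_le' hk
  rw [extZero_iff] at hA hB ⊢
  intro ξ
  obtain ⟨ξ', rfl⟩ := (ℰ.halfExactRight_extFunctor n).exists_push_of_dtmul_eq_zero
    (ℰ.isAdditive_extFunctor n) t ξ (hA _)
  rw [hB ξ', map_zero]

theorem IsExtensionOf.extZero_left' (h : ℰ.IsExtensionOf A B Z) {k : ℕ} (hk : 1 ≤ k) {X : C}
    (hB : ℰ.ExtZero k B X)
    (hZ : ℰ.ExtZero (k + 1) Z X) : ℰ.ExtZero k A X := by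
  obtain ⟨x, y, δ, t⟩ := h
  obtain ⟨n, rfl⟩ := Nat.exists_eq_add_of_le' hk
  rw [extZero_iff] at hB hZ ⊢
  intro ξ
  obtain ⟨ξ', rfl⟩ := (ℰ.halfExactLeft_extFunctor n).exists_pull_of_dtmul_eq_zero
    (ℰ.isAdditive_extFunctor n) t ξ (((ℰ.extFunctorSuccEquiv n).equiv Z X).symm.injective
      ((hZ _).trans (map_zero _).symm))
  rw [hB ξ', map_zero]

end Vanishing

end ExtriangulatedStructure

section Classes

variable {C : Type u} [Category.{v} C] [Preadditive C] [HasZeroObject C] [HasBinaryBiproducts C]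
  {ℳ : ObjectProperty C}

open scoped ZeroObject

theorem of_eq_smd (h : ℳ = smd ℳ) {M A A' : C} (hM : ℳ M) (e : A ⊞ A' ≅ M) : ℳ A := by
  rw [h]
  exact ⟨M, A', hM, ⟨e⟩⟩

theorem zero_of_eq_smd (h : ℳ = smd ℳ) {M : C} (hM : ℳ M) : ℳ (0 : C) :=
  of_eq_smd h hM ⟨(biprod.snd : (0 : C) ⊞ M ⟶ M), biprod.inr, by ext; simp, by simp⟩

end Classes

/-! ### Orthogonal classes, covers and envelopes -/

namespace ExtriangulatedStructure

variable {C : Type u} [Category.{v} C] [Preadditive C] [HasZeroObject C] [HasBinaryBiproducts C]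
  {ℰ : ExtriangulatedStructure.{w} C} {𝒜 𝒳 𝒯 : ObjectProperty C}

open scoped ZeroObject

theorem ExtZero.of_iso {k : ℕ} {X X' A : C} (h : ℰ.ExtZero k X' A) (e : X ≅ X') :
    ℰ.ExtZero k X A := by
  rw [extZero_iff] at h ⊢
  intro ξ
  rw [← AbBifunctor.pull_id _ ξ, ← e.hom_inv_id, AbBifunctor.pull_comp,
    h (AbBifunctor.pull _ _ ξ), map_zero]

theorem rightPerp_middle {A B Z : C} (h : ℰ.IsExtensionOf A B Z) (hA : ℰ.rightPerp 𝒜 A)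
    (hZ : ℰ.rightPerp 𝒜 Z) : ℰ.rightPerp 𝒜 B :=
  fun i hi X hX => h.extZero_middle hi (hA i hi X hX) (hZ i hi X hX)

theorem leftPerp_middle {A B Z : C} (h : ℰ.IsExtensionOf A B Z) (hA : ℰ.leftPerp 𝒜 A)
    (hZ : ℰ.leftPerp 𝒜 Z) : ℰ.leftPerp 𝒜 B :=
  fun i hi X hX => h.extZero_middle' hi (hA i hi X hX) (hZ i hi X hX)

theorem leftPerp_anti {ℬ : ObjectProperty C} (h : 𝒜 ≤ ℬ) : ℰ.leftPerp ℬ ≤ ℰ.leftPerp 𝒜 :=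
  fun _ hM i hi X hX => hM i hi X (h X hX)

/-- Dimension shifting along the coresolution: `𝔼ⁱ(M, Z)` lies between `𝔼ⁱ(Y₀, Z)` and `𝔼ⁱ⁺¹(N₀,
Z)`. -/
theorem coresolved_le_leftPerp : ℰ.coresolved 𝒯 𝒳 ≤ ℰ.leftPerp (ℰ.rightPerp 𝒯) := by
  rintro M ⟨n, hn⟩
  induction n generalizing M with
  | zero =>
    obtain ⟨Y, hY, ⟨e⟩⟩ := hn
    exact fun i hi Z hZ => (hZ i hi Y hY.2).of_iso e
  | succ n ih =>
    obtain ⟨Y, N, hY, -, h, hN⟩ := hn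
    exact fun i hi Z hZ => h.extZero_left' hi (hZ i hi Y hY) (ih N hN (i + 1) (by omega) Z hZ)

theorem HasFiniteCoresolution.mono {ℬ : ObjectProperty C} (h : 𝒜 ≤ ℬ) {n : ℕ} {M : C}
    (hM : ℰ.HasFiniteCoresolution 𝒜 𝒳 n M) : ℰ.HasFiniteCoresolution ℬ 𝒳 n M := by
  induction n generalizing M with
  | zero =>
    obtain ⟨Y, hY, e⟩ := hM
    exact ⟨Y, ⟨hY.1, h Y hY.2⟩, e⟩
  | succ n ih =>
    obtain ⟨Y, N, hY, hN, k, hM⟩ := hM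
    exact ⟨Y, N, h Y hY, hN, k, ih hM⟩

theorem coresolved_mono {ℬ : ObjectProperty C} (h : 𝒜 ≤ ℬ) :
    ℰ.coresolved 𝒜 𝒳 ≤ ℰ.coresolved ℬ 𝒳 :=
  fun _ ⟨n, hn⟩ => ⟨n, hn.mono h⟩

theorem exists_of_coresolved {M : C} (h : ℰ.coresolved 𝒯 𝒳 M) : ∃ T : C, 𝒯 T := by
  obtain ⟨_ | n, hn⟩ := h
  · obtain ⟨Y, hY, -⟩ := hn
    exact ⟨Y, hY.2⟩
  · obtain ⟨Y, N, hY, -⟩ := hn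
    exact ⟨Y, hY⟩

theorem extZero_of_projDim_le {k : ℕ} (h : ℰ.projDim 𝒳 𝒯 ≤ k) {T X : C} (hT : 𝒯 T) (hX : 𝒳 X)
    {j : ℕ} (hj : k < j) : ℰ.ExtZero j T X := by
  have h₁ : ℰ.projDimObj 𝒳 T ≤ k := by
    refine le_trans (le_sSup ?_) h
    exact ⟨T, hT, rfl⟩
  -- An empty set would have infimum `⊤`, contradicting the bound `k`; a nonempty one attains its
  -- infimum.
  have hne : {m : ℕ∞ | ∃ n : ℕ, m = n ∧
      ∀ k : ℕ, n < k → ∀ A : C, 𝒳 A → ℰ.ExtZero k T A}.Nonempty := by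
    by_contra hne
    rw [projDimObj, Set.not_nonempty_iff_eq_empty.1 hne, sInf_empty] at h₁
    exact ENat.natCast_ne_top k (top_le_iff.1 h₁)
  obtain ⟨n, hn, h₂⟩ := csInf_mem hne
  refine h₂ j (lt_of_le_of_lt ?_ hj) X hX
  rw [projDimObj, hn] at h₁
  exact_mod_cast h₁

theorem injDim_eq_zero (h : ∀ k : ℕ, 0 < k → ∀ A B : C, 𝒜 A → 𝒳 B → ℰ.ExtZero k A B) :
    ℰ.injDim 𝒜 𝒳 = 0 := by
  refine le_antisymm (sSup_le ?_) bot_le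
  rintro _ ⟨B, hB, rfl⟩
  exact sInf_le ⟨0, rfl, fun k hk A hA => h k hk A B hA hB⟩

/-- Objects of `𝒳 ∩ 𝒯^⊥` are covered by objects of `𝒯 ∩ 𝒳`, with kernel in `𝒳 ∩ 𝒯^⊥`. -/
theorem exists_cover (hW : ℰ.DeflationCancellation) (hsmd : 𝒳 = smd 𝒳)
    (hext : ℰ.ClosedUnderExtensions 𝒳) (h2 : ℰ.T2 𝒳 𝒯) (h3 : ℰ.T3 𝒳 𝒯) (h5 : ℰ.T5 𝒳 𝒯) {Z : C}
    (hZ : (ℰ.rightPerp 𝒯 ⊓ 𝒳) Z) :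
    ∃ K T : C, (ℰ.rightPerp 𝒯 ⊓ 𝒳) K ∧ (𝒯 ⊓ 𝒳) T ∧ ℰ.IsExtensionOf K T Z := by
  obtain ⟨T, f, hTX, hT, hf⟩ := h5 Z ⟨hZ.2, hZ.1⟩
  obtain ⟨ω, hω, hωX, hgen⟩ := h3
  obtain ⟨X', W, hX', hWω, a, g, κ, t⟩ := hgen Z hZ.2
  -- In positive length, the obstruction to extending `g` from `W` to `Y ∈ 𝒯` lies in `𝔼(N, Z)`,
  -- which is zero; the extension then factors through the precover.
  have hfac : ∃ l : W ⟶ T, l ≫ f = g := by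
    obtain ⟨_ | n, hn⟩ := hω W hWω
    · obtain ⟨Y, hY, ⟨e⟩⟩ := hn
      obtain ⟨l, hl⟩ := hf Y hY.2 (e.inv ≫ g)
      exact ⟨e.hom ≫ l, by
        rw [Category.assoc]
        exact (congrArg (e.hom ≫ ·) hl).trans (e.hom_inv_id_assoc g)⟩
    · obtain ⟨Y, N, hY, -, ⟨b, c, ε, s⟩, hN⟩ := hn
      obtain ⟨g', rfl⟩ := s.exists_desc g
        (extZero_one_iff.1 (coresolved_le_leftPerp N ⟨n, hN⟩ 1 le_rfl Z hZ.1) _)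
      obtain ⟨l, rfl⟩ := hf Y hY g'
      exact ⟨b ≫ l, by simp⟩
  obtain ⟨l, rfl⟩ := hfac
  obtain ⟨K, i, κ', s⟩ := hW l f ⟨X', a, κ, t⟩
  -- `P` is an extension of `T` by `X'`, hence lies in `𝒳`. Since `l ≫ f` factors through `f`, the
  -- other extension `K ⟶ P ⟶ W` splits and `K` is a summand of `P`.
  obtain ⟨P, i₁, p₂, i₂, p₁, t₁, t₂⟩ := exists_pullback t s
  have hP : 𝒳 P := hext ⟨_, _, _, t₁⟩ hX' hTX
  rw [AbBifunctor.pull_comp, s.pull_eq_zero, map_zero] at t₂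
  obtain ⟨e, -, -⟩ := ℰ.triangle_unique (ℰ.triangle_zero K W) t₂
  refine ⟨K, T, ⟨fun j hj T' hT' => ?_, of_eq_smd hsmd hP e⟩, ⟨hT, hTX⟩, i, f, κ', s⟩
  obtain _ | _ | j := j
  · omega
  -- By (T2) every class in `𝔼(T', K)` is pulled back from `κ'` along a map `T' ⟶ Z`; such a map
  -- factors through the precover, where `κ'` vanishes.
  · refine extZero_one_iff.2 fun δ => ?_
    obtain ⟨c, rfl⟩ := s.exists_pull_eq δ (extZero_one_iff.1 (h2 T ⟨hT, hTX⟩ 1 le_rfl T' hT') _)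
    obtain ⟨c', rfl⟩ := hf T' hT' c
    simp [AbBifunctor.pull_comp, s.pull_eq_zero]
  · exact IsExtensionOf.extZero_left ⟨i, f, κ', s⟩ (by omega)
      (h2 T ⟨hT, hTX⟩ (j + 2) (by omega) T' hT') (hZ.1 (j + 1) (by omega) T' hT')

/-- Every object of `𝒳` with `𝔼ᵏ(𝒯, X) = 0` for `k > j` embeds into an object of `𝒳 ∩ 𝒯^⊥`, with
cokernel in `(𝒯 ∩ 𝒳)^∨_𝒳`. -/
theorem exists_envelope (hW : ℰ.DeflationCancellation) (hsmd : 𝒳 = smd 𝒳)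
    (hext : ℰ.ClosedUnderExtensions 𝒳) (h2 : ℰ.T2 𝒳 𝒯) (h3 : ℰ.T3 𝒳 𝒯) (h4 : ℰ.T4 𝒳 𝒯)
    (h5 : ℰ.T5 𝒳 𝒯) (hT0 : 𝒯 (0 : C)) (j : ℕ) {X : C} (hX : 𝒳 X)
    (hj : ∀ T : C, 𝒯 T → ∀ k : ℕ, j < k → ℰ.ExtZero k T X) :
    ∃ B A : C, (ℰ.rightPerp 𝒯 ⊓ 𝒳) B ∧ (ℰ.coresolved (𝒯 ⊓ 𝒳) 𝒳 ⊓ 𝒳) A ∧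
      ℰ.IsExtensionOf X B A := by
  induction j generalizing X with
  | zero =>
    have h0 : 𝒳 (0 : C) := zero_of_eq_smd hsmd hX
    -- Here `X` is already in `𝒯^⊥`; the cokernel `0` has a coresolution of length zero because `0 ∈
    -- 𝒯 ∩ 𝒳`.
    exact ⟨X, 0, ⟨fun i hi T hT => hj T hT i hi, hX⟩,
      ⟨⟨0, 0, ⟨h0, hT0, h0⟩, ⟨Iso.refl _⟩⟩, h0⟩, _, _, _, triangle_id_zero X⟩
  | succ j ih =>
    obtain ⟨α, hα, hαX, hcog⟩ := id h4
    obtain ⟨W, X₁, hWα, hX₁, h⟩ := hcog X hX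
    obtain ⟨B₁, A₁, hB₁, hA₁, h₁⟩ := ih hX₁ fun T hT k hk =>
      h.extZero_right (by omega) ((hα W hWα).2 k (by omega) T hT) (hj T hT (k + 1) (by omega))
    obtain ⟨K, T, hK, hT, hc⟩ := exists_cover hW hsmd hext h2 h3 h5 hB₁
    obtain ⟨a, b, δ, t⟩ := h
    obtain ⟨x₁, y₁, δ₁, t₁⟩ := h₁
    obtain ⟨i, p, κ, s⟩ := hc
    -- `P` is the preimage of `X₁` under the cover `T ⟶ B₁`: it is an extension of `X₁` by `K`, and
    -- `P ⟶ T ⟶ A₁` prolongs the coresolution of `A₁` by one step.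
    obtain ⟨P, r, m, δP, hPK, hPA⟩ : ∃ (P : C) (r : P ⟶ X₁) (i' : K ⟶ P) (δP : ℰ.E.val X₁ K),
        ℰ.Triangle i' r δP ∧ ℰ.IsExtensionOf P T A₁ := by
      obtain ⟨P, h', d, e, δ'', hP, -, -, hK', -, -⟩ := ℰ.et4op s t₁
      exact ⟨P, _, _, _, hK', _, _, _, hP⟩
    have hPX : 𝒳 P := hext ⟨_, _, _, hPK⟩ hK.2 hX₁
    obtain ⟨n, hn⟩ := hA₁.1
    -- The pullback of `W` and `P` over `X₁` is the envelope: `X ⟶ Q ⟶ P` has coresolved cokernel,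
    -- and `K ⟶ Q ⟶ W` places `Q` in `𝒯^⊥`.
    obtain ⟨Q, i₁, p₂, i₂, p₁, s₁, s₂⟩ := exists_pullback t hPK
    refine ⟨Q, P, ⟨?_, hext ⟨_, _, _, s₁⟩ hX hPX⟩,
      ⟨⟨n + 1, T, A₁, hT, hA₁.2, hPA, hn⟩, hPX⟩, _, _, _, s₁⟩
    exact rightPerp_middle ⟨_, _, _, s₂⟩ hK.1 (hα W hWα).2

theorem fac_of_rightPerp (hW : ℰ.DeflationCancellation) (hsmd : 𝒳 = smd 𝒳)
    (hext : ℰ.ClosedUnderExtensions 𝒳) (h2 : ℰ.T2 𝒳 𝒯) (h3 : ℰ.T3 𝒳 𝒯) (h5 : ℰ.T5 𝒳 𝒯) (k : ℕ)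
    {Z : C} (hZ : (ℰ.rightPerp 𝒯 ⊓ 𝒳) Z) : ℰ.Fac 𝒳 𝒯 k Z := by
  induction k generalizing Z with
  | zero => trivial
  | succ k ih =>
    obtain ⟨K, T, hK, hT, h⟩ := exists_cover hW hsmd hext h2 h3 h5 hZ
    exact ⟨K, T, hK.2, hT, h, ih hK⟩

/-- As the middle terms lie in `𝒯^⊥`, each triangle raises the degree by one; after `k` steps the
degree is `i + k`, beyond the bound `N`. -/
theorem extZero_of_fac (h2 : ℰ.T2 𝒳 𝒯) {T : C} (hT : 𝒯 T) {N : ℕ}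
    (hN : ∀ X : C, 𝒳 X → ∀ j : ℕ, N < j → ℰ.ExtZero j T X) (k : ℕ) {Z : C}
    (hZ : ℰ.Fac 𝒳 𝒯 k Z) (hZX : 𝒳 Z) {i : ℕ} (hi : 1 ≤ i) (hik : N < i + k) :
    ℰ.ExtZero i T Z := by
  induction k generalizing Z i with
  | zero => exact hN Z hZX i hik
  | succ k ih =>
    obtain ⟨K, T', hK, hT', h, hF⟩ := hZ
    exact h.extZero_right hi (h2 T' hT' i hi T hT) (ih hF hK (by omega) (by omega))

end ExtriangulatedStructure

end Extri

/-! ### The theorem -/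

open Extri ExtriangulatedStructure

theorem theorem3p18 {C : Type u} [CategoryTheory.Category.{v} C] [CategoryTheory.Preadditive C]
    [CategoryTheory.Limits.HasZeroObject C] [CategoryTheory.Limits.HasBinaryBiproducts C]
    (ℰ : Extri.ExtriangulatedStructure.{w} C) (hW : ℰ.DeflationCancellation)
    (𝒳 𝒯 : CategoryTheory.ObjectProperty C)
    (hsmd : 𝒳 = Extri.smd 𝒳) (hext : ℰ.ClosedUnderExtensions 𝒳)
    (n : ℕ) (h1 : ℰ.T1 n 𝒳 𝒯) (h2 : ℰ.T2 𝒳 𝒯) (h3 : ℰ.T3 𝒳 𝒯) (h4 : ℰ.T4 𝒳 𝒯)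
    (h5 : ℰ.T5 𝒳 𝒯) :
    (𝒯 = Extri.smd 𝒯 →
      ℰ.leftPerp (ℰ.rightPerp 𝒯 ⊓ 𝒳) ⊓ 𝒳 = ℰ.leftPerp (ℰ.rightPerp 𝒯) ⊓ 𝒳 ∧
      ℰ.leftPerp (ℰ.rightPerp 𝒯) ⊓ 𝒳 = ℰ.coresolved 𝒯 𝒳 ⊓ 𝒳 ∧
      ℰ.coresolved 𝒯 𝒳 ⊓ 𝒳 = ℰ.coresolved (𝒯 ⊓ 𝒳) 𝒳 ⊓ 𝒳) ∧
    (∀ k : ℕ, max 1 (ℰ.projDim 𝒳 𝒯) ≤ (k : ℕ∞) →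
      ℰ.rightPerp 𝒯 ⊓ 𝒳 = ℰ.Fac 𝒳 𝒯 k ⊓ 𝒳) ∧
    (𝒯 = Extri.smd 𝒯 →
      ℰ.IsComplete 𝒳 (ℰ.leftPerp (ℰ.rightPerp 𝒯)) (ℰ.rightPerp 𝒯) ∧
      ℰ.IsHereditary (ℰ.leftPerp (ℰ.rightPerp 𝒯)) (ℰ.rightPerp 𝒯)) := by
  have henv : 𝒯 = smd 𝒯 → ∀ X : C, 𝒳 X → ∃ B A : C, (ℰ.rightPerp 𝒯 ⊓ 𝒳) B ∧
      (ℰ.coresolved (𝒯 ⊓ 𝒳) 𝒳 ⊓ 𝒳) A ∧ ℰ.IsExtensionOf X B A := by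
    intro hT X hX
    -- An object of the generator provides an object of `𝒯`, so closure under summands gives `0 ∈
    -- 𝒯`, where the envelope induction starts.
    obtain ⟨ω, hω, -, hgen⟩ := id h3
    obtain ⟨-, W, -, hWω, -⟩ := hgen X hX
    obtain ⟨T, hT'⟩ := exists_of_coresolved (hω W hWω)
    exact exists_envelope hW hsmd hext h2 h3 h4 h5 (zero_of_eq_smd hT hT') n hX
      fun T hT k hk => extZero_of_projDim_le h1 hT hX hk
  have hle : ℰ.coresolved (𝒯 ⊓ 𝒳) 𝒳 ≤ ℰ.leftPerp (ℰ.rightPerp 𝒯) :=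
    (coresolved_mono inf_le_left).trans coresolved_le_leftPerp
  refine ⟨fun hT => ?_, fun k hk => ?_, fun hT => ⟨⟨fun X hX => ?_, fun X hX => ?_⟩, ?_⟩⟩
  · have ha : ℰ.coresolved (𝒯 ⊓ 𝒳) 𝒳 ⊓ 𝒳 ≤ ℰ.coresolved 𝒯 𝒳 ⊓ 𝒳 :=
      inf_le_inf_right _ (coresolved_mono inf_le_left)
    have hb : ℰ.coresolved 𝒯 𝒳 ⊓ 𝒳 ≤ ℰ.leftPerp (ℰ.rightPerp 𝒯) ⊓ 𝒳 :=
      inf_le_inf_right _ coresolved_le_leftPerp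
    have hc : ℰ.leftPerp (ℰ.rightPerp 𝒯) ⊓ 𝒳 ≤ ℰ.leftPerp (ℰ.rightPerp 𝒯 ⊓ 𝒳) ⊓ 𝒳 :=
      inf_le_inf_right _ (leftPerp_anti inf_le_left)
    have hd : ℰ.leftPerp (ℰ.rightPerp 𝒯 ⊓ 𝒳) ⊓ 𝒳 ≤ ℰ.coresolved (𝒯 ⊓ 𝒳) 𝒳 ⊓ 𝒳 := by
      rintro M ⟨hM, hMX⟩
      obtain ⟨B, A, hB, hA, h⟩ := henv hT M hMX
      have hB' : ℰ.leftPerp (ℰ.rightPerp 𝒯 ⊓ 𝒳) B :=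
        leftPerp_middle h hM (leftPerp_anti inf_le_left A (hle A hA.1))
      -- The class `κ` of the cover lies in `𝔼(B, K) = 0`, so `B` is a summand of `T` and belongs to
      -- `𝒯`.
      obtain ⟨K, T, hK, hT', i, p, κ, s⟩ := exists_cover hW hsmd hext h2 h3 h5 hB
      rw [extZero_one_iff.1 (hB' 1 le_rfl K hK) κ] at s
      obtain ⟨e, -, -⟩ := ℰ.triangle_unique (triangle_inr_fst B K) s
      obtain ⟨m, hm⟩ := hA.1
      exact ⟨⟨m + 1, B, A, ⟨of_eq_smd hT hT'.1 e, hB.2⟩, hA.2, h, hm⟩, hMX⟩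
    exact ⟨le_antisymm (hd.trans (ha.trans hb)) hc, le_antisymm (hc.trans (hd.trans ha)) hb,
      le_antisymm (hb.trans (hc.trans hd)) ha⟩
  · refine le_antisymm (fun Z hZ => ⟨fac_of_rightPerp hW hsmd hext h2 h3 h5 k hZ, hZ.2⟩) ?_
    rintro Z ⟨hZ, hZX⟩
    -- The bound `N = k` suffices: `i ≥ 1` gives `k < i + k`.
    refine ⟨fun i hi T hT => extZero_of_fac h2 hT (N := k) (fun X hX j hj => ?_) k hZ hZX hi
      (by omega), hZX⟩
    exact extZero_of_projDim_le ((le_max_right _ _).trans hk) hT hX hj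
  · obtain ⟨ω, hω, hωX, hgen⟩ := id h3
    -- Salce's argument: the pushout of `X' ⟶ W` and an envelope `X' ⟶ B` is an extension of `A` by
    -- `W`, hence left orthogonal to `𝒯^⊥`, and also an extension of `X` by `B`.
    obtain ⟨X', W, hX', hWω, x, y, δ, t⟩ := hgen X hX
    obtain ⟨B, A, hB, hA, x', y', δ', t'⟩ := henv hT X' hX'
    obtain ⟨P, hP₁, hP₂⟩ := exists_pushout t t'
    exact ⟨B, P, hB, ⟨leftPerp_middle hP₁ (coresolved_le_leftPerp W (hω W hWω)) (hle A hA.1),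
      hext hP₁ (hωX W hWω) hA.2⟩, hP₂⟩
  · obtain ⟨B, A, hB, hA, h⟩ := henv hT X hX
    exact ⟨B, A, hB, ⟨hle A hA.1, hA.2⟩, h⟩
  · exact injDim_eq_zero fun k hk A B hA hB => hA.1 k hk B hB.1
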